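/- **Language.** Fix a set of user-defined base types. Type expressions are built with $\to$ from $\iota$ (individuals), the user types, and the logical types $\mathsf r$ (rigid atoms), $\mathsf a$ (atoms), $\mathsf h$ (positive formulae), $\mathsf p$ (programs), $\mathsf g$ (goals). *Object types* are those built from $\iota$, user types, $\mathsf a$, $\mathsf h$ by $\to$. Each logic variable and each nonlogical constant carries a label in $\mathbb N$. There are countably many logic variables for each label at each object type. A nonlogical constant has an object type or a type $\alpha_1\to\cdots\to\alpha_n\to\mathsf r$ ($n\ge 0$, $\alpha_k$ object types), and there are infinitely many constants for each label at each such type. Terms are simply typed $\lambda$-terms (abstraction over object types) over these symbols and the logical constants $\top_{\mathsf g},\top_{\mathsf h}$; $\wedge$ on each of $\mathsf p,\mathsf g,\mathsf h$; $\vee$ on each of $\mathsf g,\mathsf h$; $\supset_{\mathsf{gp}}:\mathsf p\to\mathsf g\to\mathsf g$; $\supset_{\mathsf{pr}}:\mathsf g\to\mathsf r\to\mathsf p$; $\Sigma_\alpha$ for $\mathsf g,\mathsf h$ and $\Pi_\alpha$ for $\mathsf g,\mathsf h,\mathsf p$ ($\alpha$ an object type). There are tacit inclusions $\mathsf r\subseteq\mathsf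 a\subseteq\mathsf h\subseteq\mathsf g$ and $\mathsf r\subseteq\mathsf p$. Terms are taken up to $\beta\eta$-conversion, and a positive formula is identified with the same formula regarded as a goal. $\mathcal U_i$ is the set of terms all of whose labels are $\le i$. Terms of type $\mathsf p$ and $\mathsf g$ are the programs and goals $$D::=A_r\mid G\supset A_r\mid D\wedge D\mid \forall x.D,\qquad G::=\top\mid A\mid G\vee G\mid G\wedge G\mid\exists x.G\mid D\supset G\mid\forall x.G .$$ A term is closed if it contains no logic variable. **Resolution.** A state is $\langle i;P;G\rangle$ with $i\in\mathbb N$, $P$ a finite collection of program formulae and $G$ a goal; a state vector is a finite list of states. A legal substitution has finite support and replaces a logic variable labelled $i$ by a term of the same type in $\mathcal U_i$. $\mathrm{elab}(P)$ is the set of clauses $\forall\vec x(G\supset A_r)$, $\forall\vec x.A_r$ obtained from the members of $P$ by splitting conjunctions, also under universal quantifiers. One step rewrites one state of a vector, its substitution $\theta$ (the identity where not mentioned) being applied to all the rest: - *null*: delete $\langle i;P;\top\rangle$; - *true*: if $A$ is an atomic goal and $\theta$ is a legal non-identity substitution with $A\theta=\top$, replace $\langle i;P;A\rangle$ by $\langle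 i;P\theta;\top\rangle$; - *backchain*: if $\forall\vec x(G\supset A_r')\in\mathrm{elab}(P)$, $\delta$ renames $\vec x$ to distinct fresh logic variables with labels $\le i$, and $\theta$ is legal with $A_r\theta=A_r'\delta\theta$, replace $\langle i;P;A_r\rangle$ by $\langle i;P\theta;G\delta\theta\rangle$; - *axiom*: the same with a clause $\forall\vec x.A_r'$, and the state is deleted; - *or*: replace $\langle i;P;G_1\vee G_2\rangle$ by $\langle i;P;G_k\rangle$, $k=1$ or $2$; - *and*: replace $\langle i;P;G_1\wedge G_2\rangle$ by the two states $\langle i;P;G_1\rangle,\langle i;P;G_2\rangle$; - *instance*: replace $\langle i;P;\exists x.G\rangle$ by $\langle i;P;G[t/x]\rangle$ for some $t\in\mathcal U_i$; - *augment*: replace $\langle i;P;D\supset G\rangle$ by $\langle i;P\cup\{D\};G\rangle$; - *generic*: replace $\langle i;P;\forall x.G\rangle$ by $\langle i+1;P;G[c/x]\rangle$ for a fresh constant $c$ labelled $i+1$. Fresh means not occurring earlier in the derivation. An SLD proof of $\langle i;P;G\rangle$ is a finite sequence of steps from it to the empty state vector; its substitution is the composite of those of its steps. **Uniform algebras.**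 A uniform applicative structure consists of sets $\mathsf D_{i,\alpha}$ ($i\in\mathbb N$, $\alpha$ a type), functions $\mathsf{App}:\mathsf D_{i,\alpha\to\beta}\times\mathsf D_{i,\alpha}\to\mathsf D_{i,\beta}$ that are extensional ($\mathsf{App}(f,d)=\mathsf{App}(f',d)$ for all $d$ implies $f=f'$), an element $\mathsf{Const}(c)\in\mathsf D_{i,\alpha}$ for each constant $c$ of type $\alpha$ and label $i$ (logical constants have label $0$), and injections $\mathsf{Inc}:\mathsf D_{i,\alpha}\to\mathsf D_{j,\alpha}$ ($i\le j$; functorial, commuting with $\mathsf{App}$) and $\mathsf D_{i,\mathsf r}\to\mathsf D_{i,\mathsf a}\to\mathsf D_{i,\mathsf h}\to\mathsf D_{i,\mathsf g}$, $\mathsf D_{i,\mathsf r}\to\mathsf D_{i,\mathsf p}$ (compatible with the former, the one from $\mathsf h$ to $\mathsf g$ also with the logical constants common to both types). On each $\mathsf D_{i,\mathsf p}$ there are a preorder $\sqsubseteq$ and an element $\top_{\mathsf p}$ with $\top_{\mathsf p}\wedge p=p=p\wedge\top_{\mathsf p}$, $p\sqsubseteq p\wedge q$, $p\wedge q\sqsubseteq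 q\wedge p$, $\mathsf{App}(f,d)\sqsubseteq\mathsf{App}(\Pi,f)$. For a distributive lattice $\Omega$ with top, an $\Omega$-valuation is a family $I_i:\mathsf D_{i,\mathsf p}\times\mathsf D_{i,\mathsf g}\to\Omega$ such that (with all inclusions tacit, and all indicated suprema and infima existing) $$I_i(r,r)=\top_\Omega,\quad I_i(p,g)\le I_{i+1}(p,g),\quad I_i(p,\top_{\mathsf g})=\top_\Omega,$$ $$I_i(p,g\wedge g')=I_i(p,g)\wedge I_i(p,g'),\quad I_i(p,g\vee g')=I_i(p,g)\vee I_i(p,g'),\quad I_i(p,q\supset g)=I_i(p\wedge q,g),$$ $$I_i(p,\mathsf{App}(\Sigma_\alpha,f))=\bigvee_{d\in \mathsf D_{i,\alpha}}I_i(p,\mathsf{App}(f,d)),\quad I_i(p,\mathsf{App}(\Pi_\alpha,f))=\bigwedge_{d\in \mathsf D_{i,\alpha}}I_i(p,\mathsf{App}(f,d)),$$ $$p\sqsubseteq p'\Rightarrow I_i(p,g)\le I_i(p',g),\qquad (g\supset r)\sqsubseteq p\Rightarrow I_i(p,g)\le I_i(p,r).$$ A uniform algebra is a uniform applicative structure with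 an interpretation $[\![t]\!]_\varphi\in\mathsf D_{i,\alpha}$ of every term $t\in\mathcal U_i$ of type $\alpha$ under every assignment $\varphi$ (mapping logic variables of type $\alpha$ and label $j$ into $\mathsf D_{j,\alpha}$), given by $\varphi$ on variables and $\mathsf{Const}$ on constants, commuting with application and inclusions, and with $\mathsf{App}([\![\lambda x.t]\!]_\varphi,d)=[\![t]\!]_{\varphi[x:=d]}$ for all $d\in\mathsf D_{i,\alpha}$; together with some $\Omega$ and an $\Omega$-valuation. For a finite program $P$, $[\![P]\!]$ is the conjunction of the interpretations of its members, and $\top_{\mathsf p}$ if $P$ is empty. **Corollary (Completeness).** Let $i\in\mathbb N$, and let $P$ be a finite closed program and $G$ a closed goal, both over $\mathcal U_i$. If $I_i([\![P]\!]_\varphi,[\![G]\!]_\varphi)=\top_\Omega$ in all uniform algebras (ranging over all $\Omega$) and under all assignments $\varphi$, then there is an SLD proof of $\langle i;P;G\rangle$ whose substitution is the identity on the free variables of $P$ and $G$. -/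

import Mathlib

universe u

namespace UCTT

/-! ## Types and signatures -/

/-- Type expressions over a set `B` of user-defined base types: individuals `ind`, rigid atoms
`rig`, atoms `atm`, positive formulae `pos`, programs `prog`, goals `goal`, function types. -/
inductive Ty (B : Type u) : Type u
  | ind : Ty B
  | base : B → Ty B
  | rig : Ty B
  | atm : Ty B
  | pos : Ty B
  | prog : Ty B
  | goal : Ty B
  | arr : Ty B → Ty B → Ty B

infixr:60 " ⇒ₜ " => Ty.arr

/-- The types at which variables exist, hence over which one abstracts and quantifies: those not
involving programs, goals, or the type of rigid atoms (for which there are only constants). -/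
def Ty.IsObj {B : Type u} : Ty B → Prop
  | .ind => True
  | .base _ => True
  | .atm => True
  | .pos => True
  | .rig => False
  | .prog => False
  | .goal => False
  | .arr α β => α.IsObj ∧ β.IsObj

/-- The types `α₁ → ⋯ → αₙ → rig` (`n ≥ 0`) of rigid predicate constants. -/
def Ty.IsRigid {B : Type u} : Ty B → Prop
  | .rig => True
  | .arr α β => α.IsObj ∧ β.IsRigid
  | _ => False

/-- A language: user-defined base types and, for each label `i`, typed nonlogical constants
labelled `i`, with an infinite supply at each level and each admissible type. -/
structure Sig where
  Base : Type u
  Con : ℕ → Ty Base → Type u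
  con_type : ∀ (i : ℕ) (α : Ty Base), Con i α → α.IsObj ∨ α.IsRigid
  con_infinite : ∀ (i : ℕ) (α : Ty Base), α.IsObj ∨ α.IsRigid → Infinite (Con i α)

/-- Free (logic) variables of type `α`: countably many for each label, at every object type. -/
structure FVar {B : Type u} (α : Ty B) : Type u where
  obj : α.IsObj
  lev : ℕ
  idx : ℕ

/-- Bound variables, as typed de Bruijn indices into a context. -/
inductive Var {B : Type u} : List (Ty B) → Ty B → Type u
  | zero {Γ : List (Ty B)} {α : Ty B} (h : α.IsObj) : Var (α :: Γ) α
  | succ {Γ : List (Ty B)} {α β : Ty B} (x : Var Γ α) : Var (β :: Γ) α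

/-- There is no variable in the empty context. -/
def Var.elimNil {B : Type u} {C : Sort*} {α : Ty B} (x : Var [] α) : C := nomatch x

/-- The logical constants. -/
inductive Log {B : Type u} : Ty B → Type u
  | topG : Log .goal
  | topH : Log .pos
  | andP : Log (.prog ⇒ₜ .prog ⇒ₜ .prog)
  | andG : Log (.goal ⇒ₜ .goal ⇒ₜ .goal)
  | andH : Log (.pos ⇒ₜ .pos ⇒ₜ .pos)
  | orG : Log (.goal ⇒ₜ .goal ⇒ₜ .goal)
  | orH : Log (.pos ⇒ₜ .pos ⇒ₜ .pos)
  | impG : Log (.prog ⇒ₜ .goal ⇒ₜ .goal)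
  | impP : Log (.goal ⇒ₜ .rig ⇒ₜ .prog)
  | sigG {α : Ty B} (h : α.IsObj) : Log ((α ⇒ₜ .goal) ⇒ₜ .goal)
  | sigH {α : Ty B} (h : α.IsObj) : Log ((α ⇒ₜ .pos) ⇒ₜ .pos)
  | piG {α : Ty B} (h : α.IsObj) : Log ((α ⇒ₜ .goal) ⇒ₜ .goal)
  | piP {α : Ty B} (h : α.IsObj) : Log ((α ⇒ₜ .prog) ⇒ₜ .prog)
  | piH {α : Ty B} (h : α.IsObj) : Log ((α ⇒ₜ .pos) ⇒ₜ .pos)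

/-! ## Terms -/

/-- Typed terms with bound variables in the context `Γ`. The inclusions between the logical types
are displayed: rigid atoms into atoms (`incAR`), atoms into positive formulae (`incHA`), rigid
atoms into programs (`incPR`), positive formulae into goals (`incGH`). The typing alone forces
terms of type `prog` and `goal` to be, up to conversion, exactly the program and goal formulae
`D ::= A_r | G ⊃ A_r | D ∧ D | ∀x.D` and
`G ::= ⊤ | A | G ∨ G | G ∧ G | ∃x.G | D ⊃ G | ∀x.G`, and no term of object type contains `⊃`. -/
inductive Term (S : Sig.{u}) : List (Ty S.Base) → Ty S.Base → Type u
  | bvar {Γ : List (Ty S.Base)} {α : Ty S.Base} (x : Var Γ α) : Term S Γ α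
  | fvar {Γ : List (Ty S.Base)} {α : Ty S.Base} (x : FVar α) : Term S Γ α
  | con {Γ : List (Ty S.Base)} {α : Ty S.Base} {i : ℕ} (c : S.Con i α) : Term S Γ α
  | log {Γ : List (Ty S.Base)} {α : Ty S.Base} (c : Log α) : Term S Γ α
  | app {Γ : List (Ty S.Base)} {α β : Ty S.Base} (s : Term S Γ (α ⇒ₜ β)) (t : Term S Γ α) :
      Term S Γ β
  | lam {Γ : List (Ty S.Base)} {α β : Ty S.Base} (h : α.IsObj) (t : Term S (α :: Γ) β) :
      Term S Γ (α ⇒ₜ β)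
  | incAR {Γ : List (Ty S.Base)} (t : Term S Γ .rig) : Term S Γ .atm
  | incHA {Γ : List (Ty S.Base)} (t : Term S Γ .atm) : Term S Γ .pos
  | incPR {Γ : List (Ty S.Base)} (t : Term S Γ .rig) : Term S Γ .prog
  | incGH {Γ : List (Ty S.Base)} (t : Term S Γ .pos) : Term S Γ .goal

/-- Symbols that can be fresh: logic variables and nonlogical constants. -/
inductive Sym (S : Sig.{u}) : Type u
  | var (α : Ty S.Base) (x : FVar α) : Sym S
  | con (i : ℕ) (α : Ty S.Base) (c : S.Con i α) : Sym S

namespace Term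

variable {S : Sig.{u}}

/-- The inclusion of atoms into goals. -/
abbrev incGA {Γ : List (Ty S.Base)} (t : Term S Γ .atm) : Term S Γ .goal := incGH (incHA t)

/-- `t.LevelLE i`: every label in `t` is at most `i`, i.e. `t` is a term over `U_i`. -/
def LevelLE (i : ℕ) : {Γ : List (Ty S.Base)} → {α : Ty S.Base} → Term S Γ α → Prop
  | _, _, bvar _ => True
  | _, _, fvar x => x.lev ≤ i
  | _, _, con (i := j) _ => j ≤ i
  | _, _, log _ => True
  | _, _, app s t => s.LevelLE i ∧ t.LevelLE i
  | _, _, lam _ t => t.LevelLE i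
  | _, _, incAR t => t.LevelLE i
  | _, _, incHA t => t.LevelLE i
  | _, _, incPR t => t.LevelLE i
  | _, _, incGH t => t.LevelLE i

/-- The logic variables and nonlogical constants occurring in a term. -/
def syms : {Γ : List (Ty S.Base)} → {α : Ty S.Base} → Term S Γ α → Set (Sym S)
  | _, _, bvar _ => ∅
  | _, _, fvar x => {.var _ x}
  | _, _, con c => {.con _ _ c}
  | _, _, log _ => ∅
  | _, _, app s t => s.syms ∪ t.syms
  | _, _, lam _ t => t.syms
  | _, _, incAR t => t.syms
  | _, _, incHA t => t.syms
  | _, _, incPR t => t.syms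
  | _, _, incGH t => t.syms

/-- A term is closed if no logic variable occurs in it. -/
def Closed {Γ : List (Ty S.Base)} {τ : Ty S.Base} (t : Term S Γ τ) : Prop :=
  ∀ (α : Ty S.Base) (x : FVar α), Sym.var α x ∉ t.syms

/-- Lifting a renaming of bound variables under a binder. -/
def liftRen {Γ Δ : List (Ty S.Base)} {β : Ty S.Base} (ρ : ∀ α, Var Γ α → Var Δ α) :
    ∀ α, Var (β :: Γ) α → Var (β :: Δ) α
  | _, .zero h => .zero h
  | _, .succ x => .succ (ρ _ x)

/-- Renaming of bound variables. -/
def rename : {Γ Δ : List (Ty S.Base)} → {τ : Ty S.Base} → (∀ α, Var Γ α → Var Δ α) →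
    Term S Γ τ → Term S Δ τ
  | _, _, _, ρ, bvar x => bvar (ρ _ x)
  | _, _, _, _, fvar x => fvar x
  | _, _, _, _, con c => con c
  | _, _, _, _, log c => log c
  | _, _, _, ρ, app s t => app (s.rename ρ) (t.rename ρ)
  | _, _, _, ρ, lam h t => lam h (t.rename (liftRen ρ))
  | _, _, _, ρ, incAR t => incAR (t.rename ρ)
  | _, _, _, ρ, incHA t => incHA (t.rename ρ)
  | _, _, _, ρ, incPR t => incPR (t.rename ρ)
  | _, _, _, ρ, incGH t => incGH (t.rename ρ)

/-- Weakening by one bound variable. -/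
def weaken {Γ : List (Ty S.Base)} {β τ : Ty S.Base} (t : Term S Γ τ) : Term S (β :: Γ) τ :=
  t.rename (fun _ x => .succ x)

/-- Lifting a substitution of terms for bound variables under a binder. -/
def liftSub {Γ Δ : List (Ty S.Base)} {β : Ty S.Base} (σ : ∀ α, Var Γ α → Term S Δ α) :
    ∀ α, Var (β :: Γ) α → Term S (β :: Δ) α
  | _, .zero h => bvar (.zero h)
  | _, .succ x => (σ _ x).weaken

/-- Simultaneous capture-avoiding substitution of terms for bound variables. -/
def bsubst : {Γ Δ : List (Ty S.Base)} → {τ : Ty S.Base} → (∀ α, Var Γ α → Term S Δ α) →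
    Term S Γ τ → Term S Δ τ
  | _, _, _, σ, bvar x => σ _ x
  | _, _, _, _, fvar x => fvar x
  | _, _, _, _, con c => con c
  | _, _, _, _, log c => log c
  | _, _, _, σ, app s t => app (s.bsubst σ) (t.bsubst σ)
  | _, _, _, σ, lam h t => lam h (t.bsubst (liftSub σ))
  | _, _, _, σ, incAR t => incAR (t.bsubst σ)
  | _, _, _, σ, incHA t => incHA (t.bsubst σ)
  | _, _, _, σ, incPR t => incPR (t.bsubst σ)
  | _, _, _, σ, incGH t => incGH (t.bsubst σ)

/-- The substitution replacing the outermost bound variable by `t`. -/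
def instSub {Γ : List (Ty S.Base)} {β : Ty S.Base} (t : Term S Γ β) :
    ∀ α, Var (β :: Γ) α → Term S Γ α
  | _, .zero _ => t
  | _, .succ x => bvar x

/-- The instantiation `s[t/x]` of the outermost bound variable. -/
def inst {Γ : List (Ty S.Base)} {β τ : Ty S.Base} (s : Term S (β :: Γ) τ) (t : Term S Γ β) :
    Term S Γ τ :=
  s.bsubst (instSub t)

/-- `App (App c s) t` for a binary logical constant `c`. -/
abbrev op2 {Γ : List (Ty S.Base)} {α β γ : Ty S.Base} (c : Log (α ⇒ₜ β ⇒ₜ γ))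
    (s : Term S Γ α) (t : Term S Γ β) : Term S Γ γ :=
  app (app (log c) s) t

/-- The quantified formula `Q x. t`, for a quantifier constant `Q`. -/
abbrev quant {Γ : List (Ty S.Base)} {α γ : Ty S.Base} (c : Log ((α ⇒ₜ γ) ⇒ₜ γ))
    (h : α.IsObj) (t : Term S (α :: Γ) γ) : Term S Γ γ :=
  app (log c) (lam h t)

/-- Conversion: the congruence generated by `β`, `η` and the identification of a positive formula
with the same formula seen as a goal (the inclusion of positive formulae into goals is tacit, so
it commutes with the logical constants common to both). Terms are always considered up to `Conv`. -/
inductive Conv : {Γ : List (Ty S.Base)} → {τ : Ty S.Base} → Term S Γ τ → Term S Γ τ → Prop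
  | refl {Γ : List (Ty S.Base)} {τ : Ty S.Base} (t : Term S Γ τ) : Conv t t
  | symm {Γ : List (Ty S.Base)} {τ : Ty S.Base} {s t : Term S Γ τ} : Conv s t → Conv t s
  | trans {Γ : List (Ty S.Base)} {τ : Ty S.Base} {s t r : Term S Γ τ} :
      Conv s t → Conv t r → Conv s r
  | app {Γ : List (Ty S.Base)} {α β : Ty S.Base} {s s' : Term S Γ (α ⇒ₜ β)} {t t' : Term S Γ α} :
      Conv s s' → Conv t t' → Conv (app s t) (app s' t')
  | lam {Γ : List (Ty S.Base)} {α β : Ty S.Base} (h : α.IsObj) {t t' : Term S (α :: Γ) β} :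
      Conv t t' → Conv (lam h t) (lam h t')
  | incAR {Γ : List (Ty S.Base)} {t t' : Term S Γ .rig} : Conv t t' → Conv (incAR t) (incAR t')
  | incHA {Γ : List (Ty S.Base)} {t t' : Term S Γ .atm} : Conv t t' → Conv (incHA t) (incHA t')
  | incPR {Γ : List (Ty S.Base)} {t t' : Term S Γ .rig} : Conv t t' → Conv (incPR t) (incPR t')
  | incGH {Γ : List (Ty S.Base)} {t t' : Term S Γ .pos} : Conv t t' → Conv (incGH t) (incGH t')
  | beta {Γ : List (Ty S.Base)} {α β : Ty S.Base} (h : α.IsObj) (s : Term S (α :: Γ) β)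
      (t : Term S Γ α) : Conv (app (lam h s) t) (s.inst t)
  | eta {Γ : List (Ty S.Base)} {α β : Ty S.Base} (h : α.IsObj) (t : Term S Γ (α ⇒ₜ β)) :
      Conv (lam h (app t.weaken (bvar (.zero h)))) t
  | inc_top {Γ : List (Ty S.Base)} : Conv (incGH (log (Γ := Γ) .topH)) (log .topG)
  | inc_and {Γ : List (Ty S.Base)} (s t : Term S Γ .pos) :
      Conv (incGH (op2 .andH s t)) (op2 .andG (incGH s) (incGH t))
  | inc_or {Γ : List (Ty S.Base)} (s t : Term S Γ .pos) :
      Conv (incGH (op2 .orH s t)) (op2 .orG (incGH s) (incGH t))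
  | inc_sig {Γ : List (Ty S.Base)} {α : Ty S.Base} (h : α.IsObj) (t : Term S (α :: Γ) .pos) :
      Conv (incGH (quant (.sigH h) h t)) (quant (.sigG h) h (incGH t))
  | inc_pi {Γ : List (Ty S.Base)} {α : Ty S.Base} (h : α.IsObj) (t : Term S (α :: Γ) .pos) :
      Conv (incGH (quant (.piH h) h t)) (quant (.piG h) h (incGH t))

/-- Terms `p t₁ ⋯ tₙ` whose head `p` is a variable or a nonlogical constant. -/
inductive Neutral {Γ : List (Ty S.Base)} : {τ : Ty S.Base} → Term S Γ τ → Prop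
  | bvar {τ : Ty S.Base} (x : Var Γ τ) : Neutral (bvar x)
  | fvar {τ : Ty S.Base} (x : FVar τ) : Neutral (fvar x)
  | con {τ : Ty S.Base} {i : ℕ} (c : S.Con i τ) : Neutral (con c)
  | app {α τ : Ty S.Base} {s : Term S Γ (α ⇒ₜ τ)} (t : Term S Γ α) :
      Neutral s → Neutral (app s t)

/-- Atomic goals: up to conversion, an included term `p t₁ ⋯ tₙ` with nonlogical head. -/
def IsAtom {Γ : List (Ty S.Base)} (G : Term S Γ .goal) : Prop :=
  (∃ N : Term S Γ .pos, Neutral N ∧ Conv G (incGH N)) ∨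
  (∃ N : Term S Γ .atm, Neutral N ∧ Conv G (incGA N)) ∨
  (∃ N : Term S Γ .rig, Neutral N ∧ Conv G (incGA (incAR N)))

/-- Elaboration of programs. `ClauseOf D Δ G A` says that the clause `∀ Δ (G ⊃ A)` (or `∀ Δ. A`,
when `G` is `none`) belongs to the elaboration of the program formula `D`; here `Δ` extends the
ambient context `Γ` by the universally quantified variables of the clause. -/
inductive ClauseOf : {Γ : List (Ty S.Base)} → Term S Γ .prog → (Δ : List (Ty S.Base)) →
    Option (Term S Δ .goal) → Term S Δ .rig → Prop
  | atom {Γ : List (Ty S.Base)} {D : Term S Γ .prog} {A : Term S Γ .rig} :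
      Conv D (incPR A) → ClauseOf D Γ none A
  | imp {Γ : List (Ty S.Base)} {D : Term S Γ .prog} {G : Term S Γ .goal} {A : Term S Γ .rig} :
      Conv D (op2 .impP G A) → ClauseOf D Γ (some G) A
  | andL {Γ : List (Ty S.Base)} {D D₁ D₂ : Term S Γ .prog} {Δ : List (Ty S.Base)}
      {G : Option (Term S Δ .goal)} {A : Term S Δ .rig} :
      Conv D (op2 .andP D₁ D₂) → ClauseOf D₁ Δ G A → ClauseOf D Δ G A
  | andR {Γ : List (Ty S.Base)} {D D₁ D₂ : Term S Γ .prog} {Δ : List (Ty S.Base)}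
      {G : Option (Term S Δ .goal)} {A : Term S Δ .rig} :
      Conv D (op2 .andP D₁ D₂) → ClauseOf D₂ Δ G A → ClauseOf D Δ G A
  | all {Γ : List (Ty S.Base)} {D : Term S Γ .prog} {α : Ty S.Base} (h : α.IsObj)
      {D' : Term S (α :: Γ) .prog} {Δ : List (Ty S.Base)}
      {G : Option (Term S Δ .goal)} {A : Term S Δ .rig} :
      Conv D (quant (.piP h) h D') → ClauseOf D' Δ G A → ClauseOf D Δ G A

end Term

open Term

/-! ## Substitutions for logic variables -/

/-- Type-preserving maps from logic variables to terms without bound variables. -/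
def Subst (S : Sig.{u}) : Type u := ∀ α : Ty S.Base, FVar α → Term S [] α

namespace Subst

variable {S : Sig.{u}}

/-- The identity substitution. -/
def id : Subst S := fun _ x => fvar x

/-- Application of a substitution to a term. -/
def apply (θ : Subst S) : {Γ : List (Ty S.Base)} → {τ : Ty S.Base} → Term S Γ τ → Term S Γ τ
  | _, _, .bvar x => .bvar x
  | _, _, .fvar x => (θ _ x).rename (fun _ y => y.elimNil)
  | _, _, .con c => .con c
  | _, _, .log c => .log c
  | _, _, .app s t => .app (θ.apply s) (θ.apply t)
  | _, _, .lam h t => .lam h (θ.apply t)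
  | _, _, .incAR t => .incAR (θ.apply t)
  | _, _, .incHA t => .incHA (θ.apply t)
  | _, _, .incPR t => .incPR (θ.apply t)
  | _, _, .incGH t => .incGH (θ.apply t)

/-- Composition in diagrammatic order: first `θ`, then `θ'`. -/
def comp (θ θ' : Subst S) : Subst S := fun α x => θ'.apply (θ α x)

/-- The logic variables moved by a substitution. -/
def dom (θ : Subst S) : Set (Σ α : Ty S.Base, FVar α) := {v | θ v.1 v.2 ≠ fvar v.2}

/-- Legal substitutions: finite support, and only terms over `U_i` are substituted for a logic
variable labelled `i`. -/
def Legal (θ : Subst S) : Prop :=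
  θ.dom.Finite ∧ ∀ (α : Ty S.Base) (x : FVar α), (θ α x).LevelLE x.lev

/-- The symbols occurring in a substitution, in its domain or in its range. -/
def syms (θ : Subst S) : Set (Sym S) := ⋃ v ∈ θ.dom, {Sym.var v.1 v.2} ∪ (θ v.1 v.2).syms

end Subst

/-! ## Resolution -/

/-- A state: an index, a program (a finite collection of program formulae) and a goal. -/
structure State (S : Sig.{u}) : Type u where
  idx : ℕ
  prog : List (Term S [] .prog)
  goal : Term S [] .goal

variable {S : Sig.{u}}

/-- Applying a substitution to a program. -/
def substProg (θ : Subst S) (P : List (Term S [] .prog)) : List (Term S [] .prog) :=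
  P.map fun D => θ.apply D

/-- Applying a substitution to a state vector. -/
def substVec (θ : Subst S) (V : List (State S)) : List (State S) :=
  V.map fun s => ⟨s.idx, substProg θ s.prog, θ.apply s.goal⟩

/-- The symbols occurring in a state. -/
def State.syms (s : State S) : Set (Sym S) := (⋃ D ∈ s.prog, D.syms) ∪ s.goal.syms

/-- The symbols occurring in a state vector. -/
def vecSyms (V : List (State S)) : Set (Sym S) := ⋃ s ∈ V, s.syms

/-- The data of a renaming-apart substitution `δ` for the bound variables `Δ` of a clause:
distinct logic variables of level at most `i`, none of them in the set `U` of used symbols. -/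
def RenamesApart (U : Set (Sym S)) (i : ℕ) {Δ : List (Ty S.Base)}
    (δ : ∀ α, Var Δ α → FVar α) : Prop :=
  (∀ α (x y : Var Δ α), δ α x = δ α y → x = y) ∧
  ∀ α (x : Var Δ α), (δ α x).lev ≤ i ∧ Sym.var α (δ α x) ∉ U

/-- The term `tδ`. -/
def applyRen {Δ : List (Ty S.Base)} (δ : ∀ α, Var Δ α → FVar α) {τ : Ty S.Base}
    (t : Term S Δ τ) : Term S [] τ :=
  t.bsubst fun α x => fvar (δ α x)

/-- The symbols introduced by a renaming-apart substitution. -/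
def renSyms {Δ : List (Ty S.Base)} (δ : ∀ α, Var Δ α → FVar α) : Set (Sym S) :=
  {s | ∃ α, ∃ x : Var Δ α, s = Sym.var α (δ α x)}

/-- `Step U V θ W V'`: one resolution step from the state vector `V` to `V'` with substitution
`θ`, where `U` is the set of symbols used so far and `W` the set of fresh symbols introduced. -/
inductive Step (U : Set (Sym S)) :
    List (State S) → Subst S → Set (Sym S) → List (State S) → Prop
  | null (V₁ V₂ : List (State S)) (i : ℕ) (P : List (Term S [] .prog)) (G : Term S [] .goal) :
      Conv G (log .topG) →
      Step U (V₁ ++ ⟨i, P, G⟩ :: V₂) .id ∅ (V₁ ++ V₂)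
  | true (V₁ V₂ : List (State S)) (i : ℕ) (P : List (Term S [] .prog)) (G : Term S [] .goal)
      (θ : Subst S) :
      IsAtom G → θ.Legal → Conv (θ.apply G) (log .topG) →
      (∃ (α : Ty S.Base) (x : FVar α), ¬ Conv (θ α x) (fvar x)) →
      Step U (V₁ ++ ⟨i, P, G⟩ :: V₂) θ ∅
        (substVec θ V₁ ++ ⟨i, substProg θ P, log .topG⟩ :: substVec θ V₂)
  | backchain (V₁ V₂ : List (State S)) (i : ℕ) (P : List (Term S [] .prog))
      (G : Term S [] .goal) (R : Term S [] .rig) (D : Term S [] .prog) (Δ : List (Ty S.Base))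
      (B : Term S Δ .goal) (A : Term S Δ .rig) (δ : ∀ α, Var Δ α → FVar α) (θ : Subst S) :
      Conv G (incGA (incAR R)) → D ∈ P → ClauseOf D Δ (some B) A → RenamesApart U i δ →
      θ.Legal → Conv (θ.apply R) (θ.apply (applyRen δ A)) →
      Step U (V₁ ++ ⟨i, P, G⟩ :: V₂) θ (renSyms δ)
        (substVec θ V₁ ++ ⟨i, substProg θ P, θ.apply (applyRen δ B)⟩ :: substVec θ V₂)
  | axiomStep (V₁ V₂ : List (State S)) (i : ℕ) (P : List (Term S [] .prog))
      (G : Term S [] .goal) (R : Term S [] .rig) (D : Term S [] .prog) (Δ : List (Ty S.Base))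
      (A : Term S Δ .rig) (δ : ∀ α, Var Δ α → FVar α) (θ : Subst S) :
      Conv G (incGA (incAR R)) → D ∈ P → ClauseOf D Δ none A → RenamesApart U i δ →
      θ.Legal → Conv (θ.apply R) (θ.apply (applyRen δ A)) →
      Step U (V₁ ++ ⟨i, P, G⟩ :: V₂) θ (renSyms δ) (substVec θ V₁ ++ substVec θ V₂)
  | orL (V₁ V₂ : List (State S)) (i : ℕ) (P : List (Term S [] .prog))
      (G G₁ G₂ : Term S [] .goal) :
      Conv G (op2 .orG G₁ G₂) →
      Step U (V₁ ++ ⟨i, P, G⟩ :: V₂) .id ∅ (V₁ ++ ⟨i, P, G₁⟩ :: V₂)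
  | orR (V₁ V₂ : List (State S)) (i : ℕ) (P : List (Term S [] .prog))
      (G G₁ G₂ : Term S [] .goal) :
      Conv G (op2 .orG G₁ G₂) →
      Step U (V₁ ++ ⟨i, P, G⟩ :: V₂) .id ∅ (V₁ ++ ⟨i, P, G₂⟩ :: V₂)
  | and (V₁ V₂ : List (State S)) (i : ℕ) (P : List (Term S [] .prog))
      (G G₁ G₂ : Term S [] .goal) :
      Conv G (op2 .andG G₁ G₂) →
      Step U (V₁ ++ ⟨i, P, G⟩ :: V₂) .id ∅ (V₁ ++ ⟨i, P, G₁⟩ :: ⟨i, P, G₂⟩ :: V₂)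
  | instance (V₁ V₂ : List (State S)) (i : ℕ) (P : List (Term S [] .prog))
      (G : Term S [] .goal) {α : Ty S.Base} (h : α.IsObj) (G' : Term S [α] .goal)
      (t : Term S [] α) :
      Conv G (quant (.sigG h) h G') → t.LevelLE i →
      Step U (V₁ ++ ⟨i, P, G⟩ :: V₂) .id ∅ (V₁ ++ ⟨i, P, G'.inst t⟩ :: V₂)
  | augment (V₁ V₂ : List (State S)) (i : ℕ) (P : List (Term S [] .prog))
      (G : Term S [] .goal) (D : Term S [] .prog) (G' : Term S [] .goal) :
      Conv G (op2 .impG D G') →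
      Step U (V₁ ++ ⟨i, P, G⟩ :: V₂) .id ∅ (V₁ ++ ⟨i, P ++ [D], G'⟩ :: V₂)
  | generic (V₁ V₂ : List (State S)) (i : ℕ) (P : List (Term S [] .prog))
      (G : Term S [] .goal) {α : Ty S.Base} (h : α.IsObj) (G' : Term S [α] .goal)
      (c : S.Con (i + 1) α) :
      Conv G (quant (.piG h) h G') → Sym.con (i + 1) α c ∉ U →
      Step U (V₁ ++ ⟨i, P, G⟩ :: V₂) .id {Sym.con (i + 1) α c}
        (V₁ ++ ⟨i + 1, P, G'.inst (con c)⟩ :: V₂)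

/-- `Deriv U V θ V'`: a finite sequence of resolution steps from `V` to `V'` whose substitutions
compose to `θ`, the symbols in `U` having been used before. -/
inductive Deriv : Set (Sym S) → List (State S) → Subst S → List (State S) → Prop
  | nil (U : Set (Sym S)) (V : List (State S)) : Deriv U V .id V
  | cons {U W : Set (Sym S)} {V V' V'' : List (State S)} {θ θ' : Subst S} :
      Step U V θ W V' → Deriv (U ∪ W ∪ θ.syms ∪ vecSyms V') V' θ' V'' →
      Deriv U V (θ.comp θ') V''

/-- A successful resolution of `V` with composite substitution `θ`: a derivation from `V` to the
empty state vector, in which fresh means not occurring earlier in the derivation. -/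
def Resolves (V : List (State S)) (θ : Subst S) : Prop := Deriv (vecSyms V) V θ []

/-! ## Uniform algebras -/

/-- The data of a levelled typed applicative structure for the language `S`. -/
structure LevelledStructure (S : Sig.{u}) where
  D : ℕ → Ty S.Base → Type u
  app : ∀ {i : ℕ} {α β : Ty S.Base}, D i (α ⇒ₜ β) → D i α → D i β
  const : ∀ {i : ℕ} {α : Ty S.Base}, S.Con i α → D i α
  logConst : ∀ {α : Ty S.Base}, Log α → D 0 α
  inc : ∀ {i j : ℕ} {α : Ty S.Base}, i ≤ j → D i α → D j α
  incAR : ∀ {i : ℕ}, D i .rig → D i .atm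
  incHA : ∀ {i : ℕ}, D i .atm → D i .pos
  incPR : ∀ {i : ℕ}, D i .rig → D i .prog
  incGH : ∀ {i : ℕ}, D i .pos → D i .goal
  leP : ∀ {i : ℕ}, D i .prog → D i .prog → Prop
  topP : ∀ i : ℕ, D i .prog

namespace LevelledStructure

variable (M : LevelledStructure S)

/-- The interpreted logical constant `c` at level `i`. -/
def lg (i : ℕ) {α : Ty S.Base} (c : Log α) : M.D i α := M.inc (Nat.zero_le i) (M.logConst c)

/-- The binary operation given by a logical constant. -/
def op {i : ℕ} {α β γ : Ty S.Base} (c : Log (α ⇒ₜ β ⇒ₜ γ)) (x : M.D i α) (y : M.D i β) : M.D i γ :=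
  M.app (M.app (M.lg i c) x) y

/-- The inclusion of atoms into goals. -/
def incGA {i : ℕ} (x : M.D i .atm) : M.D i .goal := M.incGH (M.incHA x)

/-- Assignments: elements for the logic variables, respecting types and labels. -/
def Assignment : Type u := ∀ (α : Ty S.Base) (x : FVar α), M.D x.lev α

/-- Values at level `i` for the bound variables of a context. -/
def Env (i : ℕ) (Γ : List (Ty S.Base)) : Type u := ∀ α, Var Γ α → M.D i α

/-- The empty environment. -/
def Env.nil {i : ℕ} : M.Env i [] := fun _ x => x.elimNil

variable {M} in
/-- Extending an environment by one value. -/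
def Env.cons {i : ℕ} {Γ : List (Ty S.Base)} {β : Ty S.Base} (ρ : M.Env i Γ) (d : M.D i β) :
    M.Env i (β :: Γ)
  | _, .zero _ => d
  | _, .succ x => ρ _ x

variable {M} in
/-- Raising an environment to a higher level. -/
def Env.raise {i j : ℕ} (h : i ≤ j) {Γ : List (Ty S.Base)} (ρ : M.Env i Γ) : M.Env j Γ :=
  fun _ x => M.inc h (ρ _ x)

/-- The conjunction of a finite list of program values, associated to the left; `topP` if empty. -/
def conj (i : ℕ) : List (M.D i .prog) → M.D i .prog
  | [] => M.topP i
  | p :: ps => ps.foldl (fun q q' => M.op .andP q q') p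

end LevelledStructure

/-- Uniform applicative structures. -/
structure UniformStructure (S : Sig.{u}) extends LevelledStructure S where
  ext : ∀ {i : ℕ} {α β : Ty S.Base} (f f' : D i (α ⇒ₜ β)), (∀ d, app f d = app f' d) → f = f'
  inc_self : ∀ {i : ℕ} {α : Ty S.Base} (x : D i α), inc le_rfl x = x
  inc_inc : ∀ {i j k : ℕ} {α : Ty S.Base} (h : i ≤ j) (h' : j ≤ k) (x : D i α),
    inc h' (inc h x) = inc (h.trans h') x
  inc_injective : ∀ {i j : ℕ} {α : Ty S.Base} (h : i ≤ j),
    Function.Injective (inc h : D i α → D j α)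
  inc_app : ∀ {i j : ℕ} {α β : Ty S.Base} (h : i ≤ j) (f : D i (α ⇒ₜ β)) (d : D i α),
    inc h (app f d) = app (inc h f) (inc h d)
  incAR_injective : ∀ i : ℕ, Function.Injective (incAR (i := i))
  incHA_injective : ∀ i : ℕ, Function.Injective (incHA (i := i))
  incPR_injective : ∀ i : ℕ, Function.Injective (incPR (i := i))
  incGH_injective : ∀ i : ℕ, Function.Injective (incGH (i := i))
  inc_incAR : ∀ {i j : ℕ} (h : i ≤ j) (x : D i .rig), inc h (incAR x) = incAR (inc h x)
  inc_incHA : ∀ {i j : ℕ} (h : i ≤ j) (x : D i .atm), inc h (incHA x) = incHA (inc h x)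
  inc_incPR : ∀ {i j : ℕ} (h : i ≤ j) (x : D i .rig), inc h (incPR x) = incPR (inc h x)
  inc_incGH : ∀ {i j : ℕ} (h : i ≤ j) (x : D i .pos), inc h (incGH x) = incGH (inc h x)
  /- positive formulae are included in the goals as the same formulae -/
  incGH_top : ∀ i : ℕ, incGH (toLevelledStructure.lg i .topH) = toLevelledStructure.lg i .topG
  incGH_and : ∀ {i : ℕ} (x y : D i .pos), incGH (toLevelledStructure.op .andH x y) =
    toLevelledStructure.op .andG (incGH x) (incGH y)
  incGH_or : ∀ {i : ℕ} (x y : D i .pos), incGH (toLevelledStructure.op .orH x y) =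
    toLevelledStructure.op .orG (incGH x) (incGH y)
  incGH_sig : ∀ {i : ℕ} {α : Ty S.Base} (h : α.IsObj) (f : D i (α ⇒ₜ .pos))
    (f' : D i (α ⇒ₜ .goal)), (∀ d, app f' d = incGH (app f d)) →
    incGH (app (toLevelledStructure.lg i (.sigH h)) f) =
      app (toLevelledStructure.lg i (.sigG h)) f'
  incGH_pi : ∀ {i : ℕ} {α : Ty S.Base} (h : α.IsObj) (f : D i (α ⇒ₜ .pos))
    (f' : D i (α ⇒ₜ .goal)), (∀ d, app f' d = incGH (app f d)) →
    incGH (app (toLevelledStructure.lg i (.piH h)) f) =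
      app (toLevelledStructure.lg i (.piG h)) f'
  /- the pre-ordered monoid structure on programs -/
  leP_refl : ∀ {i : ℕ} (p : D i .prog), leP p p
  leP_trans : ∀ {i : ℕ} (p q r : D i .prog), leP p q → leP q r → leP p r
  topP_and : ∀ {i : ℕ} (p : D i .prog), toLevelledStructure.op .andP (topP i) p = p
  and_topP : ∀ {i : ℕ} (p : D i .prog), toLevelledStructure.op .andP p (topP i) = p
  leP_and : ∀ {i : ℕ} (p q : D i .prog), leP p (toLevelledStructure.op .andP p q)
  and_comm : ∀ {i : ℕ} (p q : D i .prog),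
    leP (toLevelledStructure.op .andP p q) (toLevelledStructure.op .andP q p)
  leP_pi : ∀ {i : ℕ} {α : Ty S.Base} (h : α.IsObj) (f : D i (α ⇒ₜ .prog)) (d : D i α),
    leP (app f d) (app (toLevelledStructure.lg i (.piP h)) f)

/-- `Ω`-valuations on a uniform applicative structure. -/
structure Valuation (M : UniformStructure S) (Ω : Type u) [DistribLattice Ω] [OrderTop Ω] where
  I : ∀ i : ℕ, M.D i .prog → M.D i .goal → Ω
  atom : ∀ (i : ℕ) (r : M.D i .rig), I i (M.incPR r) (M.incGA (M.incAR r)) = ⊤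
  mono : ∀ (i : ℕ) (p : M.D i .prog) (g : M.D i .goal),
    I i p g ≤ I (i + 1) (M.inc (Nat.le_succ i) p) (M.inc (Nat.le_succ i) g)
  top : ∀ (i : ℕ) (p : M.D i .prog), I i p (M.lg i .topG) = ⊤
  and : ∀ (i : ℕ) (p : M.D i .prog) (g g' : M.D i .goal),
    I i p (M.op .andG g g') = I i p g ⊓ I i p g'
  or : ∀ (i : ℕ) (p : M.D i .prog) (g g' : M.D i .goal),
    I i p (M.op .orG g g') = I i p g ⊔ I i p g'
  imp : ∀ (i : ℕ) (p q : M.D i .prog) (g : M.D i .goal),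
    I i p (M.op .impG q g) = I i (M.op .andP p q) g
  sig : ∀ (i : ℕ) (p : M.D i .prog) {α : Ty S.Base} (h : α.IsObj) (f : M.D i (α ⇒ₜ .goal)),
    IsLUB (Set.range fun d => I i p (M.app f d)) (I i p (M.app (M.lg i (.sigG h)) f))
  pi : ∀ (i : ℕ) (p : M.D i .prog) {α : Ty S.Base} (h : α.IsObj) (f : M.D i (α ⇒ₜ .goal)),
    IsGLB (Set.range fun d => I i p (M.app f d)) (I i p (M.app (M.lg i (.piG h)) f))
  incl : ∀ (i : ℕ) (p p' : M.D i .prog) (g : M.D i .goal), M.leP p p' → I i p g ≤ I i p' g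
  backchain : ∀ (i : ℕ) (p : M.D i .prog) (g : M.D i .goal) (r : M.D i .rig),
    M.leP (M.op .impP g r) p → I i p g ≤ I i p (M.incGA (M.incAR r))

/-- Uniform algebras: a uniform applicative structure, an interpretation `eval` of terms (at every
level bounding that of the term), an object of truth values and a valuation. By extensionality the
condition `eval_lam` determines the interpretation of an abstraction uniquely. -/
structure UniformAlgebra (S : Sig.{u}) extends UniformStructure S where
  eval : ∀ {Γ : List (Ty S.Base)} {τ : Ty S.Base} (i : ℕ) (_ : toLevelledStructure.Assignment)
    (_ : toLevelledStructure.Env i Γ) (t : Term S Γ τ), t.LevelLE i → D i τ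
  eval_raise : ∀ {Γ : List (Ty S.Base)} {τ : Ty S.Base} {i j : ℕ} (h : i ≤ j)
    (φ : toLevelledStructure.Assignment) (ρ : toLevelledStructure.Env i Γ) (t : Term S Γ τ)
    (hi : t.LevelLE i) (hj : t.LevelLE j), eval j φ (ρ.raise h) t hj = inc h (eval i φ ρ t hi)
  eval_bvar : ∀ {Γ : List (Ty S.Base)} {τ : Ty S.Base} (i : ℕ)
    (φ : toLevelledStructure.Assignment) (ρ : toLevelledStructure.Env i Γ) (x : Var Γ τ)
    (h : (bvar x : Term S Γ τ).LevelLE i), eval i φ ρ (bvar x) h = ρ τ x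
  eval_fvar : ∀ {Γ : List (Ty S.Base)} {τ : Ty S.Base} (i : ℕ)
    (φ : toLevelledStructure.Assignment) (ρ : toLevelledStructure.Env i Γ) (x : FVar τ)
    (h : x.lev ≤ i), eval i φ ρ (fvar x) h = inc h (φ τ x)
  eval_con : ∀ {Γ : List (Ty S.Base)} {τ : Ty S.Base} (i j : ℕ)
    (φ : toLevelledStructure.Assignment) (ρ : toLevelledStructure.Env i Γ) (c : S.Con j τ)
    (h : j ≤ i), eval i φ ρ (con c) h = inc h (const c)
  eval_log : ∀ {Γ : List (Ty S.Base)} {τ : Ty S.Base} (i : ℕ)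
    (φ : toLevelledStructure.Assignment) (ρ : toLevelledStructure.Env i Γ) (c : Log τ)
    (h : (log c : Term S Γ τ).LevelLE i),
    eval i φ ρ (log c) h = inc (Nat.zero_le i) (logConst c)
  eval_app : ∀ {Γ : List (Ty S.Base)} {α β : Ty S.Base} (i : ℕ)
    (φ : toLevelledStructure.Assignment) (ρ : toLevelledStructure.Env i Γ)
    (s : Term S Γ (α ⇒ₜ β)) (t : Term S Γ α) (hs : s.LevelLE i) (ht : t.LevelLE i),
    eval i φ ρ (Term.app s t) ⟨hs, ht⟩ = app (eval i φ ρ s hs) (eval i φ ρ t ht)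
  eval_lam : ∀ {Γ : List (Ty S.Base)} {α β : Ty S.Base} (i : ℕ)
    (φ : toLevelledStructure.Assignment) (ρ : toLevelledStructure.Env i Γ) (h : α.IsObj)
    (t : Term S (α :: Γ) β) (ht : t.LevelLE i) (d : D i α),
    app (eval i φ ρ (Term.lam h t) ht) d = eval i φ (ρ.cons d) t ht
  eval_incAR : ∀ {Γ : List (Ty S.Base)} (i : ℕ) (φ : toLevelledStructure.Assignment)
    (ρ : toLevelledStructure.Env i Γ) (t : Term S Γ .rig) (h : t.LevelLE i),
    eval i φ ρ (Term.incAR t) h = incAR (eval i φ ρ t h)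
  eval_incHA : ∀ {Γ : List (Ty S.Base)} (i : ℕ) (φ : toLevelledStructure.Assignment)
    (ρ : toLevelledStructure.Env i Γ) (t : Term S Γ .atm) (h : t.LevelLE i),
    eval i φ ρ (Term.incHA t) h = incHA (eval i φ ρ t h)
  eval_incPR : ∀ {Γ : List (Ty S.Base)} (i : ℕ) (φ : toLevelledStructure.Assignment)
    (ρ : toLevelledStructure.Env i Γ) (t : Term S Γ .rig) (h : t.LevelLE i),
    eval i φ ρ (Term.incPR t) h = incPR (eval i φ ρ t h)
  eval_incGH : ∀ {Γ : List (Ty S.Base)} (i : ℕ) (φ : toLevelledStructure.Assignment)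
    (ρ : toLevelledStructure.Env i Γ) (t : Term S Γ .pos) (h : t.LevelLE i),
    eval i φ ρ (Term.incGH t) h = incGH (eval i φ ρ t h)
  Ω : Type u
  [lattice : DistribLattice Ω]
  [orderTop : OrderTop Ω]
  val : Valuation toUniformStructure Ω

attribute [instance] UniformAlgebra.lattice UniformAlgebra.orderTop

namespace UniformAlgebra

variable (𝔄 : UniformAlgebra S)

/-- The interpretation at level `i` of a program over `U_i`. -/
def evalProg (i : ℕ) (φ : 𝔄.Assignment) (P : List (Term S [] .prog))
    (hP : ∀ D ∈ P, D.LevelLE i) : 𝔄.D i .prog :=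
  𝔄.conj i (P.pmap (fun D h => 𝔄.eval i φ (LevelledStructure.Env.nil _) D h) hP)

/-- The truth value `I_i(⟦P⟧, ⟦G⟧)`. -/
def truth (i : ℕ) (φ : 𝔄.Assignment) (P : List (Term S [] .prog)) (G : Term S [] .goal)
    (hP : ∀ D ∈ P, D.LevelLE i) (hG : G.LevelLE i) : 𝔄.Ω :=
  𝔄.val.I i (𝔄.evalProg i φ P hP) (𝔄.eval i φ (LevelledStructure.Env.nil _) G hG)

end UniformAlgebra

end UCTT

namespace UCTT

open Term

variable {S : Sig.{u}}

/-! Validity is tested in one uniform algebra, a term model. Truth there yields a derivation in an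
unlabelled calculus of uniform proofs, `Prv`, and such a derivation is then turned into an SLD
proof.

Quantification over positive formulae is impredicative, so truth cannot be defined by recursion on
formulae. As in the Takahashi–Prawitz treatment of type theory, a logical value is a formula
together with an upward closed set of programs, each of which proves it (`Val`). Functions are
set-theoretic, but must be tracked by a term when all arguments have object types. Every term tracks
its own value (`evalTr`, `tr_evalTr`), so truth of `G` at `p` gives `Prv p G`. The equations of an
algebra must hold strictly: hence the sum types for the chain of inclusions, the formal neutral
program `none`, and the case distinction in `goalSig` and `goalPi`.

The order on programs is inclusion of clause instances. That `App(f,d)` lies below `App(Π,f)` then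
means that a clause of an instance of a program is an instance of a clause of it (`ClauseOf.lift`).
This needs the outermost form of a program to exist and to be determined up to conversion. Neither
confluence nor normalisation is used: uniqueness comes from a conversion-invariant evaluator
(`Conv.shape`), existence from a logical predicate (`forms_bsubst`).

The model ignores labels. They are restored in `Prv.exists_deriv` by a symbol map that sends all
logic variables and constants to constants labelled at most `i`; at a universal goal the premise for
a fresh constant is used, and that constant is sent to a fresh one labelled `i + 1`. All states so
obtained are closed, so unifiers act only on the renamed clause variables. -/

/-- Bound variables have object types. -/
theorem Var.isObj {B : Type u} {Γ : List (Ty B)} {α : Ty B} : Var Γ α → α.IsObj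
  | .zero h => h
  | .succ x => x.isObj

/-! ## Simultaneous replacement of bound variables, logic variables and constants -/

/-- Terms replacing the bound variables of `Γ`, the logic variables and the constants. -/
@[ext] structure GSub (S : Sig.{u}) (Γ Δ : List (Ty S.Base)) : Type u where
  b : ∀ α, Var Γ α → Term S Δ α
  f : ∀ α, FVar α → Term S Δ α
  k : ∀ (i : ℕ) (α : Ty S.Base), S.Con i α → Term S Δ α

namespace GSub

variable {Γ Δ Θ : List (Ty S.Base)}

/-- Lifting under a binder. -/
def lift {β : Ty S.Base} (ς : GSub S Γ Δ) : GSub S (β :: Γ) (β :: Δ) where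
  b := liftSub ς.b
  f α x := (ς.f α x).weaken
  k i α c := (ς.k i α c).weaken

/-- Renaming the bound variables of all the replacing terms. -/
def ren (ς : GSub S Γ Δ) (ρ : ∀ α, Var Δ α → Var Θ α) : GSub S Γ Θ where
  b α x := (ς.b α x).rename ρ
  f α x := (ς.f α x).rename ρ
  k i α c := (ς.k i α c).rename ρ

/-- Precomposition with a renaming of the bound variables. -/
def pre (ς : GSub S Δ Θ) (ρ : ∀ α, Var Γ α → Var Δ α) : GSub S Γ Θ where
  b α x := ς.b α (ρ α x)
  f := ς.f
  k := ς.k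

/-- Replacement of bound variables only. -/
def ofB (σ : ∀ α, Var Γ α → Term S Δ α) : GSub S Γ Δ where
  b := σ
  f _ x := fvar x
  k _ _ c := con c

end GSub

namespace Term

/-- Simultaneous replacement. -/
def gsub : {Γ Δ : List (Ty S.Base)} → {τ : Ty S.Base} → GSub S Γ Δ → Term S Γ τ → Term S Δ τ
  | _, _, _, ς, bvar x => ς.b _ x
  | _, _, _, ς, fvar x => ς.f _ x
  | _, _, _, ς, con c => ς.k _ _ c
  | _, _, _, _, log c => log c
  | _, _, _, ς, app s t => app (s.gsub ς) (t.gsub ς)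
  | _, _, _, ς, lam h t => lam h (t.gsub ς.lift)
  | _, _, _, ς, incAR t => incAR (t.gsub ς)
  | _, _, _, ς, incHA t => incHA (t.gsub ς)
  | _, _, _, ς, incPR t => incPR (t.gsub ς)
  | _, _, _, ς, incGH t => incGH (t.gsub ς)

end Term

/-- Composition of replacements. -/
def GSub.comp {Γ Δ Θ : List (Ty S.Base)} (ς : GSub S Γ Δ) (ς' : GSub S Δ Θ) : GSub S Γ Θ where
  b α x := (ς.b α x).gsub ς'
  f α x := (ς.f α x).gsub ς'
  k i α c := (ς.k i α c).gsub ς'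

/-! ### Calculus of replacements and its compatibility with conversion -/

namespace Term

variable {Γ Δ Θ : List (Ty S.Base)} {τ : Ty S.Base}

theorem liftRen_liftRen {β : Ty S.Base} (ρ : ∀ α, Var Γ α → Var Δ α)
    (ρ' : ∀ α, Var Δ α → Var Θ α) (α : Ty S.Base) (x : Var (β :: Γ) α) :
    liftRen ρ' α (liftRen ρ α x) = liftRen (fun α x => ρ' α (ρ α x)) α x := by
  cases x <;> rfl

theorem rename_rename (t : Term S Γ τ) (ρ : ∀ α, Var Γ α → Var Δ α)
    (ρ' : ∀ α, Var Δ α → Var Θ α) :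
    (t.rename ρ).rename ρ' = t.rename (fun α x => ρ' α (ρ α x)) := by
  induction t generalizing Δ Θ with
  | lam h t ih =>
    simp only [rename, ih]
    congr 2
    funext α x
    exact liftRen_liftRen ρ ρ' α x
  | _ => simp_all only [rename]

theorem weaken_rename {β : Ty S.Base} (t : Term S Γ τ) (ρ : ∀ α, Var Γ α → Var Δ α) :
    (t.weaken (β := β)).rename (liftRen ρ) = (t.rename ρ).weaken := by
  simp only [weaken, rename_rename]
  rfl

theorem gsub_rename (t : Term S Γ τ) (ρ : ∀ α, Var Γ α → Var Δ α) (ς : GSub S Δ Θ) :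
    (t.rename ρ).gsub ς = t.gsub (ς.pre ρ) := by
  induction t generalizing Δ Θ with
  | lam h t ih =>
    simp only [rename, gsub, ih]
    congr 2
    ext α x
    · cases x <;> rfl
    · rfl
    · rfl
  | _ => simp_all only [rename, gsub, GSub.pre]

theorem rename_gsub (t : Term S Γ τ) (ς : GSub S Γ Δ) (ρ : ∀ α, Var Δ α → Var Θ α) :
    (t.gsub ς).rename ρ = t.gsub (ς.ren ρ) := by
  induction t generalizing Δ Θ with
  | lam h t ih =>
    simp only [rename, gsub, ih]
    congr 2
    ext α x
    · cases x
      · rfl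
      · exact weaken_rename _ _
    · exact weaken_rename _ _
    · exact weaken_rename _ _
  | _ => simp_all only [rename, gsub, GSub.ren]

theorem weaken_gsub {β : Ty S.Base} (t : Term S Γ τ) (ς : GSub S Γ Δ) :
    (t.weaken (β := β)).gsub ς.lift = (t.gsub ς).weaken := by
  rw [weaken, weaken, gsub_rename, rename_gsub]
  rfl

theorem gsub_gsub (t : Term S Γ τ) (ς : GSub S Γ Δ) (ς' : GSub S Δ Θ) :
    (t.gsub ς).gsub ς' = t.gsub (ς.comp ς') := by
  induction t generalizing Δ Θ with
  | lam h t ih =>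
    simp only [gsub, ih]
    congr 2
    ext α x
    · cases x
      · rfl
      · exact weaken_gsub _ _
    · exact weaken_gsub _ _
    · exact weaken_gsub _ _
  | _ => simp_all only [gsub, GSub.comp]

/-- Renaming, substitution for bound variables (`bsubst_eq_gsub`) and substitution for logic
variables (`Subst.apply_eq_gsub`) are all special replacements, so stability of conversion has to be
proved only for `gsub`. -/
theorem rename_eq_gsub (t : Term S Γ τ) (ρ : ∀ α, Var Γ α → Var Δ α) :
    t.rename ρ = t.gsub (.ofB fun α x => bvar (ρ α x)) := by
  induction t generalizing Δ with
  | lam h t ih =>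
    simp only [rename, gsub, ih]
    congr 2
    ext α x
    · cases x <;> rfl
    · rfl
    · rfl
  | _ => simp_all only [rename, gsub, GSub.ofB]

theorem bsubst_eq_gsub (t : Term S Γ τ) (σ : ∀ α, Var Γ α → Term S Δ α) :
    t.bsubst σ = t.gsub (.ofB σ) := by
  induction t generalizing Δ with
  | lam h t ih =>
    simp only [bsubst, gsub, ih]
    rfl
  | _ => simp_all only [bsubst, gsub, GSub.ofB]

theorem gsub_bvar (t : Term S Γ τ) : t.gsub (.ofB fun _ x => bvar x) = t := by
  rw [← bsubst_eq_gsub]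
  induction t with
  | @lam Γ α β h t ih =>
    simp only [bsubst]
    congr 1
    convert ih using 2
    funext α x
    cases x <;> rfl
  | _ => simp_all only [bsubst]

theorem bsubst_bsubst (t : Term S Γ τ) (σ : ∀ α, Var Γ α → Term S Δ α)
    (σ' : ∀ α, Var Δ α → Term S Θ α) :
    (t.bsubst σ).bsubst σ' = t.bsubst fun α x => (σ α x).bsubst σ' := by
  simp only [bsubst_eq_gsub, gsub_gsub]
  rfl

theorem bsubst_bvar (t : Term S Γ τ) : (t.bsubst fun _ x => bvar x) = t := by
  rw [bsubst_eq_gsub, gsub_bvar]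

theorem bsubst_nil (t : Term S [] τ) (σ : ∀ α, Var [] α → Term S [] α) : t.bsubst σ = t := by
  have : σ = fun _ x => bvar x := by
    funext α x
    exact x.elimNil
  rw [this, bsubst_bvar]

theorem weaken_bsubst {β : Ty S.Base} (t : Term S Γ τ) (σ : ∀ α, Var (β :: Γ) α → Term S Δ α) :
    t.weaken.bsubst σ = t.bsubst fun α x => σ α (.succ x) := by
  rw [bsubst_eq_gsub, bsubst_eq_gsub, weaken, gsub_rename]
  rfl

theorem weaken_inst {β : Ty S.Base} (t : Term S Γ τ) (s : Term S Γ β) :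
    t.weaken.inst s = t := by
  rw [inst, weaken_bsubst]
  exact bsubst_bvar t

theorem gsub_inst {β : Ty S.Base} (s : Term S (β :: Γ) τ) (t : Term S Γ β) (ς : GSub S Γ Δ) :
    (s.inst t).gsub ς = (s.gsub ς.lift).inst (t.gsub ς) := by
  simp only [inst, bsubst_eq_gsub, gsub_gsub]
  congr 1
  ext α x
  · cases x with
    | zero h => rfl
    | succ x =>
      change ς.b α x = (ς.b α x).weaken.gsub _
      rw [← bsubst_eq_gsub]
      exact (weaken_inst _ _).symm
  · change ς.f α x = (ς.f α x).weaken.gsub _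
    rw [← bsubst_eq_gsub]
    exact (weaken_inst _ _).symm
  · change ς.k _ _ _ = (ς.k _ _ _).weaken.gsub _
    rw [← bsubst_eq_gsub]
    exact (weaken_inst _ _).symm

/-- Conversion is preserved by replacement. -/
theorem Conv.gsub {s t : Term S Γ τ} (h : Conv s t) (ς : GSub S Γ Δ) :
    Conv (s.gsub ς) (t.gsub ς) := by
  induction h generalizing Δ with
  | refl t => exact .refl _
  | symm _ ih => exact (ih ς).symm
  | trans _ _ ih ih' => exact (ih ς).trans (ih' ς)
  | app _ _ ih ih' => exact .app (ih ς) (ih' ς)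
  | lam h _ ih => exact .lam h (ih _)
  | incAR _ ih => exact .incAR (ih ς)
  | incHA _ ih => exact .incHA (ih ς)
  | incPR _ ih => exact .incPR (ih ς)
  | incGH _ ih => exact .incGH (ih ς)
  | beta h s t =>
    rw [gsub_inst]
    exact .beta h _ _
  | eta h t =>
    simp only [Term.gsub, weaken_gsub]
    exact .eta h _
  | inc_top => exact .inc_top
  | inc_and s t => exact .inc_and _ _
  | inc_or s t => exact .inc_or _ _
  | inc_sig h t => exact .inc_sig h _
  | inc_pi h t => exact .inc_pi h _

theorem Conv.bsubst {s t : Term S Γ τ} (h : Conv s t) (σ : ∀ α, Var Γ α → Term S Δ α) :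
    Conv (s.bsubst σ) (t.bsubst σ) := by
  simp only [bsubst_eq_gsub]
  exact h.gsub _

theorem Conv.weaken {β : Ty S.Base} {s t : Term S Γ τ} (h : Conv s t) :
    Conv (s.weaken (β := β)) t.weaken := by
  simp only [Term.weaken, rename_eq_gsub]
  exact h.gsub _

/-- Substitution of convertible terms. -/
theorem Conv.bsubst_right (t : Term S Γ τ) {σ σ' : ∀ α, Var Γ α → Term S Δ α}
    (h : ∀ α x, Conv (σ α x) (σ' α x)) : Conv (t.bsubst σ) (t.bsubst σ') := by
  induction t generalizing Δ with
  | bvar x => exact h _ x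
  | app s t ih ih' => exact .app (ih h) (ih' h)
  | lam hα t ih =>
    refine .lam hα (ih fun α x => ?_)
    cases x with
    | zero h => exact .refl _
    | succ x => exact (h _ x).weaken
  | incAR t ih => exact .incAR (ih h)
  | incHA t ih => exact .incHA (ih h)
  | incPR t ih => exact .incPR (ih h)
  | incGH t ih => exact .incGH (ih h)
  | _ => exact .refl _

/-- The body of the `η`-expansion. -/
abbrev etaBody {α β : Ty S.Base} (h : α.IsObj) (t : Term S Γ (α ⇒ₜ β)) : Term S (α :: Γ) β :=
  .app t.weaken (bvar (.zero h))

theorem etaBody_inst {α β : Ty S.Base} (h : α.IsObj) (t : Term S Γ (α ⇒ₜ β)) (s : Term S Γ α) :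
    (etaBody h t).inst s = .app t s := by
  have := weaken_inst t s
  simp only [inst] at this
  simp [inst, Term.bsubst, this, instSub]

/-- A single β-step: weakening the body and putting the new bound variable back for the abstracted
one gives the body again. -/
theorem Conv.etaBody_lam {α β : Ty S.Base} (h : α.IsObj) (t : Term S (α :: Γ) β) :
    Conv (etaBody h (Term.lam h t)) t := by
  have h1 : Conv (etaBody h (Term.lam h t)) _ := Conv.beta h _ _
  refine h1.trans ?_
  rw [inst, rename_eq_gsub, bsubst_eq_gsub, gsub_gsub]
  convert Conv.refl t
  convert gsub_bvar t using 2
  ext α x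
  · cases x <;> rfl
  · rfl
  · rfl

/-- Applying both abstractions to a new bound variable undoes them, so no confluence argument is
needed. -/
theorem Conv.lam_injective {α β : Ty S.Base} {h h' : α.IsObj} {s t : Term S (α :: Γ) β}
    (hc : Conv (Term.lam h s) (Term.lam h' t)) : Conv s t :=
  (Conv.etaBody_lam h s).symm.trans
    ((Conv.app hc.weaken (.refl _)).trans (Conv.etaBody_lam h t))

/-- Replacements agreeing on the symbols of a term have the same effect on it. -/
theorem gsub_congr (t : Term S Γ τ) {ς ς' : GSub S Γ Δ} (hb : ς.b = ς'.b)
    (hf : ∀ α x, Sym.var α x ∈ t.syms → ς.f α x = ς'.f α x)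
    (hk : ∀ i α c, Sym.con i α c ∈ t.syms → ς.k i α c = ς'.k i α c) :
    t.gsub ς = t.gsub ς' := by
  induction t generalizing Δ with
  | bvar x => simp [gsub, hb]
  | fvar x => exact hf _ x rfl
  | con c => exact hk _ _ c rfl
  | log c => rfl
  | app s t ih ih' =>
    simp only [gsub]
    rw [ih hb (fun α x h => hf α x (.inl h)) (fun i α c h => hk i α c (.inl h)),
      ih' hb (fun α x h => hf α x (.inr h)) (fun i α c h => hk i α c (.inr h))]
  | lam h t ih =>
    simp only [gsub]
    rw [ih (ς := ς.lift) (ς' := ς'.lift) (by simp [GSub.lift, hb])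
      (fun α x h => by simp [GSub.lift, hf α x h]) (fun i α c h => by simp [GSub.lift, hk i α c h])]
  | incAR t ih => simp only [gsub]; rw [ih hb hf hk]
  | incHA t ih => simp only [gsub]; rw [ih hb hf hk]
  | incPR t ih => simp only [gsub]; rw [ih hb hf hk]
  | incGH t ih => simp only [gsub]; rw [ih hb hf hk]

/-! ### Symbols and labels under replacement; fresh constants -/

theorem syms_finite (t : Term S Γ τ) : t.syms.Finite := by
  induction t with
  | app s t ih ih' => exact ih.union ih'
  | _ => simp_all only [syms, Set.finite_empty, Set.finite_singleton]

theorem syms_rename (t : Term S Γ τ) (ρ : ∀ α, Var Γ α → Var Δ α) : (t.rename ρ).syms = t.syms := by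
  induction t generalizing Δ with
  | _ => simp_all only [rename, syms]

theorem levelLE_rename (t : Term S Γ τ) (ρ : ∀ α, Var Γ α → Var Δ α) {i : ℕ} :
    (t.rename ρ).LevelLE i ↔ t.LevelLE i := by
  induction t generalizing Δ with
  | _ => simp_all only [rename, LevelLE]

theorem levelLE_gsub (t : Term S Γ τ) (ς : GSub S Γ Δ) {i : ℕ}
    (hb : ∀ α x, (ς.b α x).LevelLE i) (hf : ∀ α x, (ς.f α x).LevelLE i)
    (hk : ∀ j α c, (ς.k j α c).LevelLE i) : (t.gsub ς).LevelLE i := by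
  induction t generalizing Δ with
  | bvar x => exact hb _ x
  | fvar x => exact hf _ x
  | con c => exact hk _ _ c
  | log c => trivial
  | app s t ih ih' => exact ⟨ih ς hb hf hk, ih' ς hb hf hk⟩
  | lam h t ih =>
    refine ih ς.lift (fun α x => ?_) (fun α x => (levelLE_rename _ _).2 (hf α x))
      (fun j α c => (levelLE_rename _ _).2 (hk j α c))
    cases x with
    | zero h => trivial
    | succ x => exact (levelLE_rename _ _).2 (hb _ x)
  | incAR t ih => exact ih ς hb hf hk
  | incHA t ih => exact ih ς hb hf hk
  | incPR t ih => exact ih ς hb hf hk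
  | incGH t ih => exact ih ς hb hf hk

theorem closed_gsub (t : Term S Γ τ) (ς : GSub S Γ Δ)
    (hb : ∀ α x, (ς.b α x).Closed) (hf : ∀ α x, (ς.f α x).Closed)
    (hk : ∀ j α c, (ς.k j α c).Closed) : (t.gsub ς).Closed := by
  induction t generalizing Δ with
  | bvar x => exact hb _ x
  | fvar x => exact hf _ x
  | con c => exact hk _ _ c
  | log c => exact fun α x h => h
  | app s t ih ih' => exact fun α x h => h.elim (ih ς hb hf hk α x) (ih' ς hb hf hk α x)
  | lam h t ih =>
    have hw : ∀ {β τ : Ty S.Base} {t : Term S Δ τ}, t.Closed → (t.weaken (β := β)).Closed := by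
      intro β τ t ht α x
      rw [weaken, syms_rename]
      exact ht α x
    refine ih ς.lift (fun α x => ?_) (fun α x => hw (hf α x)) (fun j α c => hw (hk j α c))
    cases x with
    | zero h => exact fun α x h => h
    | succ x => exact hw (hb _ x)
  | incAR t ih => exact ih ς hb hf hk
  | incHA t ih => exact ih ς hb hf hk
  | incPR t ih => exact ih ς hb hf hk
  | incGH t ih => exact ih ς hb hf hk

open Classical in
/-- Two terms that agree on a fresh constant are convertible. -/
theorem Conv.of_fresh {α β : Ty S.Base} (hα : α.IsObj) {t t' : Term S Γ (α ⇒ₜ β)} {i : ℕ}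
    (c : S.Con i α) (hc : Sym.con i α c ∉ t.syms) (hc' : Sym.con i α c ∉ t'.syms)
    (h : Conv (Term.app t (con c)) (.app t' (con c))) : Conv t t' := by
  -- The constant is abstracted: `c` becomes the outermost bound variable and everything else is
  -- weakened. The hypothesis then relates the bodies of the two η-expansions.
  let ς : GSub S Γ (α :: Γ) :=
    { b := fun _ x => bvar (.succ x)
      f := fun _ x => fvar x
      k := fun j β d => if e : Sym.con j β d = Sym.con i α c then
        (by cases e; exact bvar (.zero hα)) else con d }
  have hw : ∀ s : Term S Γ (α ⇒ₜ β), Sym.con i α c ∉ s.syms → s.gsub ς = s.weaken := by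
    intro s hs
    rw [Term.weaken, rename_eq_gsub]
    refine gsub_congr s rfl (fun _ _ _ => rfl) fun j β d hd => ?_
    have : Sym.con j β d ≠ Sym.con i α c := fun e => hs (e ▸ hd)
    simp [ς, this, GSub.ofB]
  have h1 := h.gsub ς
  simp only [Term.gsub, hw t hc, hw t' hc'] at h1
  have hz : ς.k i α c = bvar (.zero hα) := by simp [ς]
  rw [hz] at h1
  exact (Conv.eta hα t).symm.trans ((Conv.lam hα h1).trans (Conv.eta hα t'))

end Term

/-! ## Program forms are determined up to conversion -/

namespace Term

variable {Γ Δ : List (Ty S.Base)} {τ : Ty S.Base}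

/-- Convertibility classes of terms. -/
def Cls (S : Sig.{u}) (Δ : List (Ty S.Base)) (τ : Ty S.Base) : Type u :=
  Quot (Conv : Term S Δ τ → Term S Δ τ → Prop)

/-- The class of a term. -/
def cls (t : Term S Δ τ) : Cls S Δ τ := Quot.mk _ t

theorem Conv.equivalence : Equivalence (Conv : Term S Δ τ → Term S Δ τ → Prop) :=
  ⟨.refl, .symm, .trans⟩

theorem cls_eq {s t : Term S Δ τ} : cls s = cls t ↔ Conv s t := by
  have h := Quot.eq (r := (Conv : Term S Δ τ → Term S Δ τ → Prop)) (x := s) (y := t)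
  rw [Conv.equivalence.eqvGen_iff] at h
  exact h

theorem Conv.of_out (t : Term S Δ τ) : Conv (cls t).out t :=
  cls_eq.1 (Quot.out_eq _)

/-- The outermost form of a program, its constituents being taken up to conversion. -/
inductive Shape (S : Sig.{u}) (Δ : List (Ty S.Base)) : Type u
  | none
  | atom (A : Cls S Δ .rig)
  | imp (G : Cls S Δ .goal) (A : Cls S Δ .rig)
  | and (D D' : Cls S Δ .prog)
  | pi (α : Ty S.Base) (F : Cls S Δ (α ⇒ₜ .prog))

/-- The values of the evaluator computing the outermost forms of programs. -/
def Sh (S : Sig.{u}) (Δ : List (Ty S.Base)) : Ty S.Base → Type u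
  | .prog => Shape S Δ
  | .arr σ τ => Cls S Δ σ → Sh S Δ τ
  | _ => PUnit

/-- A default value. -/
def Sh.dflt : (τ : Ty S.Base) → Sh S Δ τ
  | .prog => Shape.none
  | .arr _ τ => fun _ => Sh.dflt τ
  | .ind => PUnit.unit
  | .base _ => PUnit.unit
  | .rig => PUnit.unit
  | .atm => PUnit.unit
  | .pos => PUnit.unit
  | .goal => PUnit.unit

/-- An object type never ends in `prog`, so its values carry no information. Hence the default value
given to a bound variable agrees with the value of whatever is substituted for it, which is the
variable case of `shape_bsubst`. -/
theorem Sh.subsingleton : {τ : Ty S.Base} → τ.IsObj → ∀ x y : Sh S Δ τ, x = y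
  | .arr _ _, h, x, y => funext fun q => Sh.subsingleton h.2 (x q) (y q)
  | .ind, _, _, _ => rfl
  | .base _, _, _, _ => rfl
  | .atm, _, _, _ => rfl
  | .pos, _, _, _ => rfl
  | .rig, h, _, _ => h.elim
  | .goal, h, _, _ => h.elim
  | .prog, h, _, _ => h.elim

/-- Extension of a substitution by one term. -/
def consSub {β : Ty S.Base} (σ : ∀ α, Var Γ α → Term S Δ α) (s : Term S Δ β) :
    ∀ α, Var (β :: Γ) α → Term S Δ α
  | _, .zero _ => s
  | _, .succ x => σ _ x

/-- The outermost form of a logical constant. -/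
def Log.shape : {τ : Ty S.Base} → Log τ → Sh S Δ τ
  | _, .andP => fun a b => Shape.and a b
  | _, .impP => fun a b => Shape.imp a b
  | _, .piP (α := α) _ => fun a => Shape.pi α a
  | _, .topG => Sh.dflt _
  | _, .topH => Sh.dflt _
  | _, .andG => Sh.dflt _
  | _, .andH => Sh.dflt _
  | _, .orG => Sh.dflt _
  | _, .orH => Sh.dflt _
  | _, .impG => Sh.dflt _
  | _, .sigG _ => Sh.dflt _
  | _, .sigH _ => Sh.dflt _
  | _, .piG _ => Sh.dflt _
  | _, .piH _ => Sh.dflt _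

/-- The evaluator computing the outermost forms of programs. -/
noncomputable def shape : {Γ Δ : List (Ty S.Base)} → {τ : Ty S.Base} → Term S Γ τ →
    (∀ α, Var Γ α → Term S Δ α) → Sh S Δ τ
  | _, _, _, bvar _, _ => Sh.dflt _
  | _, _, _, fvar _, _ => Sh.dflt _
  | _, _, _, con _, _ => Sh.dflt _
  | _, _, _, log c, _ => Log.shape c
  -- Arguments are passed as classes of terms rather than as values, since the result has to record
  -- the constituents of a form up to conversion.
  | _, _, _, app s t, σ => s.shape σ (cls (t.bsubst σ))
  -- The representative `q.out` is arbitrary; `shape_congr` makes the choice immaterial.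
  | _, _, _, lam _ t, σ => fun q => t.shape (consSub σ q.out)
  | _, _, _, incPR t, σ => Shape.atom (cls (t.bsubst σ))
  | _, _, _, incAR _, _ => PUnit.unit
  | _, _, _, incHA _, _ => PUnit.unit
  | _, _, _, incGH _, _ => PUnit.unit

theorem consSub_conv {β : Ty S.Base} {σ σ' : ∀ α, Var Γ α → Term S Δ α}
    (h : ∀ α x, Conv (σ α x) (σ' α x)) {s s' : Term S Δ β} (hs : Conv s s') (α : Ty S.Base)
    (x : Var (β :: Γ) α) : Conv (consSub σ s α x) (consSub σ' s' α x) := by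
  cases x with
  | zero => exact hs
  | succ x => exact h _ x

theorem shape_congr (t : Term S Γ τ) {σ σ' : ∀ α, Var Γ α → Term S Δ α}
    (h : ∀ α x, Conv (σ α x) (σ' α x)) : t.shape σ = t.shape σ' := by
  induction t generalizing Δ with
  | app s t ih ih' =>
    simp only [shape, ih h]
    rw [cls_eq.2 (Conv.bsubst_right t h)]
  | lam hα t ih =>
    simp only [shape]
    funext q
    exact ih (consSub_conv h (.refl _))
  | incPR t ih =>
    simp only [shape]
    rw [cls_eq.2 (Conv.bsubst_right t h)]
  | _ => rfl

theorem shape_bsubst {Θ : List (Ty S.Base)} (t : Term S Γ τ) (σ : ∀ α, Var Γ α → Term S Δ α)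
    (σ' : ∀ α, Var Δ α → Term S Θ α) :
    (t.bsubst σ).shape σ' = t.shape fun α x => (σ α x).bsubst σ' := by
  induction t generalizing Δ Θ with
  | bvar x => exact Sh.subsingleton x.isObj _ _
  | app s t ih ih' => simp only [bsubst, shape, ih, bsubst_bsubst]
  | lam hα t ih =>
    simp only [bsubst, shape, ih]
    funext q
    congr 1
    funext α x
    cases x with
    | zero => rfl
    | succ x =>
      change ((σ _ x).weaken).bsubst _ = (σ _ x).bsubst σ'
      rw [weaken_bsubst]
      rfl
  | incPR t ih => simp only [bsubst, shape, bsubst_bsubst]; rfl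
  | _ => rfl

/-- This invariant separates the program forms. A β-step is `shape_bsubst` combined with
independence of the representative; the identifications along `incGH` are invisible because values
at type `goal` are trivial. -/
theorem Conv.shape {s t : Term S Γ τ} (h : Conv s t) {σ σ' : ∀ α, Var Γ α → Term S Δ α}
    (hσ : ∀ α x, Conv (σ α x) (σ' α x)) : s.shape σ = t.shape σ' := by
  induction h generalizing Δ with
  | refl t => exact shape_congr t hσ
  | symm _ ih => exact (ih fun α x => (hσ α x).symm).symm
  | trans _ _ ih ih' => exact (ih hσ).trans (ih' fun _ _ => .refl _)
  | @app _ _ _ _ _ t t' h h' ih ih' =>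
    simp only [Term.shape, ih hσ]
    rw [cls_eq.2 ((Conv.bsubst_right t hσ).trans (h'.bsubst σ'))]
  | lam h _ ih =>
    simp only [Term.shape]
    funext q
    exact ih (consSub_conv hσ (.refl _))
  | @incPR _ t t' h ih =>
    simp only [Term.shape]
    rw [cls_eq.2 ((Conv.bsubst_right t hσ).trans (h.bsubst σ'))]
  | beta h s t =>
    simp only [Term.shape, inst, shape_bsubst]
    refine shape_congr s fun α x => ?_
    cases x with
    | zero => exact (Conv.of_out _).trans (Conv.bsubst_right t hσ)
    | succ x => exact hσ _ x
  | @eta _ α β h t =>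
    simp only [Term.shape]
    funext q
    rw [Term.weaken, rename_eq_gsub, ← bsubst_eq_gsub, shape_bsubst]
    rw [show cls ((Term.bvar (.zero h)).bsubst (consSub σ q.out)) = q from Quot.out_eq q]
    exact congrFun (shape_congr t hσ) q
  | _ => rfl

/-- The outermost form of a program. -/
noncomputable abbrev progShape (D : Term S Γ .prog) : Shape S Γ := D.shape fun _ x => bvar x

theorem Conv.progShape {D D' : Term S Γ .prog} (h : Conv D D') :
    D.progShape = D'.progShape :=
  h.shape fun _ _ => .refl _

theorem progShape_atom (A : Term S Γ .rig) : (incPR A).progShape = .atom (cls A) := by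
  simp [Term.shape, bsubst_bvar]

theorem progShape_imp (G : Term S Γ .goal) (A : Term S Γ .rig) :
    (op2 .impP G A).progShape = .imp (cls G) (cls A) := by
  simp [Term.shape, bsubst_bvar, Log.shape]

theorem progShape_and (D D' : Term S Γ .prog) :
    (op2 .andP D D').progShape = .and (cls D) (cls D') := by
  simp [Term.shape, bsubst_bvar, Log.shape]

theorem progShape_pi {α : Ty S.Base} (h : α.IsObj) (F : Term S Γ (α ⇒ₜ .prog)) :
    (Term.app (log (.piP h)) F).progShape = .pi α (cls F) := by
  simp [Term.shape, bsubst_bvar, Log.shape]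

/-- The program forms. -/
inductive ProgForm (D : Term S Γ .prog) : Prop
  | atom (A : Term S Γ .rig) (h : Conv D (incPR A))
  | imp (G : Term S Γ .goal) (A : Term S Γ .rig) (h : Conv D (op2 .impP G A))
  | and (D₁ D₂ : Term S Γ .prog) (h : Conv D (op2 .andP D₁ D₂))
  | pi (α : Ty S.Base) (hα : α.IsObj) (D' : Term S (α :: Γ) .prog)
      (h : Conv D (quant (.piP hα) hα D'))

/-- Terms yielding a program form when applied to sufficiently many arguments. -/
def Forms : {τ : Ty S.Base} → Term S Γ τ → Prop
  | .prog, t => ProgForm t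
  | .arr _ _, t => ∀ s, Forms (Term.app t s)
  | _, _ => True

theorem Forms.conv : {τ : Ty S.Base} → {t t' : Term S Γ τ} → Conv t t' → Forms t → Forms t'
  | .prog, _, _, h, ht => match ht with
    | .atom A h' => .atom A (h.symm.trans h')
    | .imp G A h' => .imp G A (h.symm.trans h')
    | .and D D' h' => .and D D' (h.symm.trans h')
    | .pi α hα D' h' => .pi α hα D' (h.symm.trans h')
  | .arr _ _, _, _, h, ht => fun s => (ht s).conv (.app h (.refl s))
  | .ind, _, _, _, _ => trivial
  | .base _, _, _, _, _ => trivial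
  | .atm, _, _, _, _ => trivial
  | .pos, _, _, _, _ => trivial
  | .rig, _, _, _, _ => trivial
  | .goal, _, _, _, _ => trivial

theorem forms_of_isObj : {τ : Ty S.Base} → τ.IsObj → (t : Term S Γ τ) → Forms t
  | .arr _ _, h, _ => fun _ => forms_of_isObj h.2 _
  | .ind, _, _ => trivial
  | .base _, _, _ => trivial
  | .atm, _, _ => trivial
  | .pos, _, _ => trivial
  | .rig, _, _ => trivial
  | .goal, _, _ => trivial
  | .prog, h, _ => h.elim

theorem forms_of_isRigid : {τ : Ty S.Base} → τ.IsRigid → (t : Term S Γ τ) → Forms t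
  | .arr _ _, h, _ => fun _ => forms_of_isRigid h.2 _
  | .rig, _, _ => trivial
  | .ind, h, _ => h.elim
  | .base _, h, _ => h.elim
  | .atm, h, _ => h.elim
  | .pos, h, _ => h.elim
  | .goal, h, _ => h.elim
  | .prog, h, _ => h.elim

/-- The types of variables and nonlogical constants never end in `prog`, so only `andP`, `impP`,
`piP` and `incPR` can produce a program. The substitution is carried along to make the induction
pass through abstractions. -/
theorem forms_bsubst (t : Term S Γ τ) (σ : ∀ α, Var Γ α → Term S Δ α) : Forms (t.bsubst σ) := by
  induction t generalizing Δ with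
  | bvar x => exact forms_of_isObj x.isObj _
  | fvar x => exact forms_of_isObj x.obj _
  | con c => exact (S.con_type _ _ c).elim (forms_of_isObj · _) (forms_of_isRigid · _)
  | log c =>
    cases c with
    | andP => exact fun s t => .and s t (.refl _)
    | impP => exact fun s t => .imp s t (.refl _)
    | piP h => exact fun s => .pi _ h (etaBody h s) (.app (.refl _) (Conv.eta h s).symm)
    | topG | topH => trivial
    | sigG | sigH | piG | piH => exact fun _ => trivial
    | _ => exact fun _ _ => trivial
  | app s t ih _ => exact ih σ _
  | @lam _ α β h t ih =>
    intro s
    refine Forms.conv (.symm ?_) (ih (consSub σ s))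
    refine (Conv.beta h _ _).trans ?_
    rw [inst, bsubst_bsubst]
    refine Conv.bsubst_right _ fun α x => ?_
    cases x with
    | zero => exact .refl _
    | succ x =>
      change Conv ((σ _ x).weaken.inst s) (σ _ x)
      rw [weaken_inst]
      exact .refl _
  | incPR t => exact .atom _ (.refl _)
  | _ => trivial

theorem progForm (D : Term S Γ .prog) : ProgForm D := by
  have := forms_bsubst D (fun _ x => bvar x)
  rwa [bsubst_bvar] at this

/-! ### Clauses of conjunctions and of instances of programs -/

theorem Conv.and_injective {D D' E E' : Term S Γ .prog}
    (h : Conv (op2 .andP D D') (op2 .andP E E')) : Conv D E ∧ Conv D' E' := by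
  have := h.progShape
  rw [progShape_and, progShape_and] at this
  injection this with h1 h2
  exact ⟨cls_eq.1 h1, cls_eq.1 h2⟩

theorem ClauseOf.conv {D D' : Term S Γ .prog} {G : Option (Term S Δ .goal)}
    {A : Term S Δ .rig} (h : Conv D' D) (hc : ClauseOf D Δ G A) : ClauseOf D' Δ G A := by
  cases hc with
  | atom h' => exact .atom (h.trans h')
  | imp h' => exact .imp (h.trans h')
  | andL h' hc => exact .andL (h.trans h') hc
  | andR h' hc => exact .andR (h.trans h') hc
  | all hα h' hc => exact .all hα (h.trans h') hc

theorem ClauseOf.of_and {D D' : Term S Γ .prog} {G : Option (Term S Δ .goal)}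
    {A : Term S Δ .rig} (hc : ClauseOf (op2 .andP D D') Δ G A) :
    ClauseOf D Δ G A ∨ ClauseOf D' Δ G A := by
  cases hc with
  | atom h => have := h.progShape; rw [progShape_and, progShape_atom] at this; cases this
  | imp h => have := h.progShape; rw [progShape_and, progShape_imp] at this; cases this
  | andL h hc => exact .inl (hc.conv h.and_injective.1)
  | andR h hc => exact .inr (hc.conv h.and_injective.2)
  | all hα h hc => have := h.progShape; rw [progShape_and, progShape_pi] at this; cases this

/-- A clause of an instance of a program formula is an instance of a clause of the formula. -/
theorem ClauseOf.lift {Γ' : List (Ty S.Base)} {D : Term S Γ' .prog} {G : Option (Term S Δ .goal)}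
    {A : Term S Δ .rig} (hc : ClauseOf D Δ G A) (E : Term S Γ .prog)
    (σ : ∀ α, Var Γ α → Term S Γ' α) (h : Conv D (E.bsubst σ)) :
    ∃ (Δ' : List (Ty S.Base)) (G' : Option (Term S Δ' .goal)) (A' : Term S Δ' .rig)
      (σ' : ∀ α, Var Δ' α → Term S Δ α), ClauseOf E Δ' G' A' ∧
      Option.Rel Conv (G'.map fun t => t.bsubst σ') G ∧ Conv (A'.bsubst σ') A := by
  induction hc generalizing Γ with
  | @atom _ D A h' =>
    -- Substitution preserves the outermost form of `E`, so comparing shapes rules out all forms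
    -- except the one prescribed by the clause; injectivity of shapes then identifies the
    -- constituents.
    obtain ⟨A', hE⟩ | ⟨G', A', hE⟩ | ⟨D₁, D₂, hE⟩ | ⟨α, hα, E', hE⟩ := progForm E
    all_goals
      have hs := ((hE.bsubst σ).symm.trans (h.symm.trans h')).progShape
      simp only [bsubst, progShape_atom, progShape_imp, progShape_and, progShape_pi,
        reduceCtorEq] at hs
    · injection hs with hs
      exact ⟨_, none, A', σ, .atom hE, .none, cls_eq.1 hs⟩
  | @imp _ D G A h' =>
    obtain ⟨A', hE⟩ | ⟨G', A', hE⟩ | ⟨D₁, D₂, hE⟩ | ⟨α, hα, E', hE⟩ := progForm E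
    all_goals
      have hs := ((hE.bsubst σ).symm.trans (h.symm.trans h')).progShape
      simp only [bsubst, progShape_atom, progShape_imp, progShape_and, progShape_pi,
        reduceCtorEq] at hs
    · injection hs with hs hs'
      exact ⟨_, some G', A', σ, .imp hE, .some (cls_eq.1 hs), cls_eq.1 hs'⟩
  | andL h' _ ih =>
    obtain ⟨A', hE⟩ | ⟨G', A', hE⟩ | ⟨D₁, D₂, hE⟩ | ⟨α, hα, E', hE⟩ := progForm E
    all_goals
      have hs := ((hE.bsubst σ).symm.trans (h.symm.trans h')).progShape
      simp only [bsubst, progShape_atom, progShape_imp, progShape_and, progShape_pi,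
        reduceCtorEq] at hs
    · injection hs with hs hs'
      obtain ⟨Δ', G', A', σ', h1, h2⟩ := ih D₁ σ (cls_eq.1 hs).symm
      exact ⟨Δ', G', A', σ', .andL hE h1, h2⟩
  | andR h' _ ih =>
    obtain ⟨A', hE⟩ | ⟨G', A', hE⟩ | ⟨D₁, D₂, hE⟩ | ⟨α, hα, E', hE⟩ := progForm E
    all_goals
      have hs := ((hE.bsubst σ).symm.trans (h.symm.trans h')).progShape
      simp only [bsubst, progShape_atom, progShape_imp, progShape_and, progShape_pi,
        reduceCtorEq] at hs
    · injection hs with hs hs'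
      obtain ⟨Δ', G', A', σ', h1, h2⟩ := ih D₂ σ (cls_eq.1 hs').symm
      exact ⟨Δ', G', A', σ', .andR hE h1, h2⟩
  | all hβ h' _ ih =>
    obtain ⟨A', hE⟩ | ⟨G', A', hE⟩ | ⟨D₁, D₂, hE⟩ | ⟨α, hα, E', hE⟩ := progForm E
    all_goals
      have hs := ((hE.bsubst σ).symm.trans (h.symm.trans h')).progShape
      simp only [bsubst, progShape_atom, progShape_imp, progShape_and, progShape_pi,
        reduceCtorEq] at hs
    · injection hs with hs hs'
      -- Equality of shapes also identifies the types of the two quantified variables; only then can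
      -- the bodies be compared.
      subst hs
      have hs' := cls_eq.1 (eq_of_heq hs')
      obtain ⟨Δ', G', A', σ', h1, h2⟩ := ih E' (liftSub σ) hs'.lam_injective.symm
      exact ⟨Δ', G', A', σ', .all hα hE h1, h2⟩

end Term

/-! ## Instances of clauses and unlabelled uniform provability -/

/-- `D` has a clause with the closed instance `G ⊃ A` (or `A`, when `G` is `none`). -/
def Inst (D : Term S [] .prog) (G : Option (Term S [] .goal)) (A : Term S [] .rig) : Prop :=
  ∃ (Δ : List (Ty S.Base)) (G' : Option (Term S Δ .goal)) (A' : Term S Δ .rig)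
    (σ : ∀ α, Var Δ α → Term S [] α), ClauseOf D Δ G' A' ∧
    Option.Rel Conv (G'.map fun t => t.bsubst σ) G ∧ Conv (A'.bsubst σ) A

theorem Inst.conv {D D' : Term S [] .prog} (h : Conv D D') {G : Option (Term S [] .goal)}
    {A : Term S [] .rig} : Inst D G A → Inst D' G A := by
  rintro ⟨Δ, G', A', σ, hc, h'⟩
  exact ⟨Δ, G', A', σ, hc.conv h.symm, h'⟩

theorem Inst.atom (A : Term S [] .rig) : Inst (incPR A) none A :=
  ⟨[], none, A, fun _ x => bvar x, .atom (.refl _), .none, by rw [bsubst_bvar]; exact .refl _⟩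

theorem Inst.imp (G : Term S [] .goal) (A : Term S [] .rig) : Inst (op2 .impP G A) (some G) A :=
  ⟨[], some G, A, fun _ x => bvar x, .imp (.refl _),
    .some (by simp only [bsubst_bvar]; exact .refl _), by rw [bsubst_bvar]; exact .refl _⟩

theorem inst_and {D D' : Term S [] .prog} {G : Option (Term S [] .goal)} {A : Term S [] .rig} :
    Inst (op2 .andP D D') G A ↔ Inst D G A ∨ Inst D' G A := by
  constructor
  · rintro ⟨Δ, G', A', σ, hc, h'⟩
    exact hc.of_and.imp (fun hc => ⟨Δ, G', A', σ, hc, h'⟩) (fun hc => ⟨Δ, G', A', σ, hc, h'⟩)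
  · rintro (⟨Δ, G', A', σ, hc, h'⟩ | ⟨Δ, G', A', σ, hc, h'⟩)
    · exact ⟨Δ, G', A', σ, .andL (.refl _) hc, h'⟩
    · exact ⟨Δ, G', A', σ, .andR (.refl _) hc, h'⟩

theorem optRel_conv_trans {Γ : List (Ty S.Base)} {x y z : Option (Term S Γ .goal)}
    (h : Option.Rel Conv x y) (h' : Option.Rel Conv y z) : Option.Rel Conv x z := by
  cases h with
  | none => exact h'
  | some h => cases h' with | some h' => exact .some (h.trans h')

/-- Up to β, `F s` is a substitution instance of the body of the η-expansion of `F`. `ClauseOf.lift`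
pulls its clause back to that body, and the two substitutions compose. -/
theorem Inst.pi {α : Ty S.Base} (hα : α.IsObj) {F : Term S [] (α ⇒ₜ .prog)} {s : Term S [] α}
    {G : Option (Term S [] .goal)} {A : Term S [] .rig} (h : Inst (Term.app F s) G A) :
    Inst (Term.app (log (.piP hα)) F) G A := by
  obtain ⟨Δ, G', A', σ, hc, hG, hA⟩ := h
  have := hc.lift (etaBody hα F) (instSub s)
    (by rw [show bsubst (instSub s) (etaBody hα F) = _ from etaBody_inst hα F s]; exact .refl _)
  obtain ⟨Δ', G'', A'', σ', hc', hG', hA'⟩ := this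
  refine ⟨Δ', G'', A'', fun α x => (σ' α x).bsubst σ,
    .all hα (.app (.refl _) (Conv.eta hα F).symm) hc', ?_, ?_⟩
  · refine optRel_conv_trans ?_ hG
    cases G'' with
    | none => cases G' with
      | none => exact .none
      | some g => cases hG'
    | some g => cases G' with
      | none => cases hG'
      | some g' =>
        cases hG' with
        | some h =>
          refine .some ?_
          simp only [← bsubst_bsubst]
          exact h.bsubst σ
  · rw [← bsubst_bsubst]
    exact (hA'.bsubst σ).trans hA

/-- Programs, with a formal neutral element. -/
abbrev World (S : Sig.{u}) : Type u := Option (Term S [] .prog)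

namespace World

/-- Conjunction with strict neutral element. -/
def and : World S → World S → World S
  | none, q => q
  | some p, none => some p
  | some p, some q => some (op2 .andP p q)

/-- Instances of clauses of a program. -/
def Inst : World S → Option (Term S [] .goal) → Term S [] .rig → Prop
  | none, _, _ => False
  | some D, G, A => UCTT.Inst D G A

/-- Inclusion of programs: every clause instance of `p` is one of `q`. -/
def le (p q : World S) : Prop := ∀ G A, p.Inst G A → q.Inst G A

theorem and_none (p : World S) : p.and none = p := by cases p <;> rfl

theorem inst_and {p q : World S} {G : Option (Term S [] .goal)} {A : Term S [] .rig} :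
    (p.and q).Inst G A ↔ p.Inst G A ∨ q.Inst G A := by
  cases p <;> cases q <;> simp [and, Inst, UCTT.inst_and]

theorem le_and {p p' : World S} (h : p.le p') (q : World S) : (p.and q).le (p'.and q) := by
  intro G A hi
  rw [inst_and] at hi ⊢
  exact hi.imp_left (h G A)

end World

/-- Uniform provability without labels; the eigenvariable condition is replaced by the requirement
that all instances with constants be provable. -/
inductive Prv : World S → Term S [] .goal → Prop
  | conv {p : World S} {G G' : Term S [] .goal} : Conv G G' → Prv p G → Prv p G'
  | top (p : World S) : Prv p (log .topG)
  | and {p : World S} {G G' : Term S [] .goal} : Prv p G → Prv p G' → Prv p (op2 .andG G G')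
  | orL {p : World S} {G : Term S [] .goal} (G' : Term S [] .goal) :
      Prv p G → Prv p (op2 .orG G G')
  | orR {p : World S} (G : Term S [] .goal) {G' : Term S [] .goal} :
      Prv p G' → Prv p (op2 .orG G G')
  | imp {p : World S} {D : Term S [] .prog} {G : Term S [] .goal} :
      Prv (p.and (some D)) G → Prv p (op2 .impG D G)
  | sig {p : World S} {α : Ty S.Base} (h : α.IsObj) {F : Term S [] (α ⇒ₜ .goal)}
      (s : Term S [] α) : Prv p (.app F s) → Prv p (.app (log (.sigG h)) F)
  | pi {p : World S} {α : Ty S.Base} (h : α.IsObj) {F : Term S [] (α ⇒ₜ .goal)} :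
      (∀ (i : ℕ) (c : S.Con i α), Prv p (.app F (con c))) → Prv p (.app (log (.piG h)) F)
  | clause {p : World S} {G : Term S [] .goal} {A : Term S [] .rig} :
      p.Inst (some G) A → Prv p G → Prv p (incGA (incAR A))
  | fact {p : World S} {A : Term S [] .rig} : p.Inst none A → Prv p (incGA (incAR A))

/-- A program enters a proof only through its clause instances. This makes the truth set of a rigid
atom upward closed. -/
theorem Prv.mono {p p' : World S} {G : Term S [] .goal} (h : Prv p G) (hp : p.le p') :
    Prv p' G := by
  induction h generalizing p' with
  | conv hc _ ih => exact .conv hc (ih hp)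
  | top => exact .top _
  | and _ _ ih ih' => exact .and (ih hp) (ih' hp)
  | orL G' _ ih => exact .orL G' (ih hp)
  | orR G _ ih => exact .orR G (ih hp)
  | imp _ ih => exact .imp (ih (World.le_and hp _))
  | sig h s _ ih => exact .sig h s (ih hp)
  | pi h _ ih => exact .pi h fun i c => ih i c hp
  | clause hi _ ih => exact .clause (hp _ _ hi) (ih hp)
  | fact hi => exact .fact (hp _ _ hi)

/-! ## The domains of the term model -/

/-- A formula (in a type embedded into the goals by `emb`) with a set of programs proving it. -/
structure Val {τ : Ty S.Base} (emb : Term S [] τ → Term S [] .goal) : Type u where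
  syn : Term S [] τ
  -- Only soundness and upward closure are imposed: the set may be smaller than that of all programs
  -- proving the formula. This freedom is what permits impredicative quantification over values.
  truth : Set (World S)
  sound : ∀ p ∈ truth, Prv p (emb syn)
  up : ∀ p p', p.le p' → p ∈ truth → p' ∈ truth

/-- Values of atoms. -/
abbrev AtmDom (S : Sig.{u}) : Type u := Term S [] .rig ⊕ Val (S := S) (fun t => incGA t)
/-- Values of positive formulae. -/
abbrev PosDom (S : Sig.{u}) : Type u := AtmDom S ⊕ Val (S := S) (fun t => incGH t)
/-- Values of goals. -/
abbrev GoalDom (S : Sig.{u}) : Type u := PosDom S ⊕ Val (S := S) (τ := .goal) id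

/-- The underlying term. -/
def AtmDom.syn : AtmDom S → Term S [] .atm
  | .inl r => incAR r
  | .inr v => v.syn

/-- The underlying term. -/
def PosDom.syn : PosDom S → Term S [] .pos
  | .inl a => incHA (AtmDom.syn a)
  | .inr v => v.syn

/-- The underlying term. -/
def GoalDom.syn : GoalDom S → Term S [] .goal
  | .inl x => incGH (PosDom.syn x)
  | .inr v => v.syn

/-- The programs at which a value is true. -/
def AtmDom.truth : AtmDom S → Set (World S)
  -- A rigid atom is true exactly where it is provable, so that the valuation axioms for atoms and
  -- backchaining become the rules `fact` and `clause`.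
  | .inl r => {p | Prv p (incGA (incAR r))}
  | .inr v => v.truth

/-- The programs at which a value is true. -/
def PosDom.truth : PosDom S → Set (World S)
  | .inl a => AtmDom.truth a
  | .inr v => v.truth

/-- The programs at which a value is true. -/
def GoalDom.truth : GoalDom S → Set (World S)
  | .inl x => PosDom.truth x
  | .inr v => v.truth

/-! ### Soundness and monotonicity of logical values -/

theorem AtmDom.sound (a : AtmDom S) {p : World S} (h : p ∈ AtmDom.truth a) :
    Prv p (incGA (AtmDom.syn a)) := by
  cases a with
  | inl r => exact h
  | inr v => exact v.sound p h

theorem PosDom.sound (x : PosDom S) {p : World S} (h : p ∈ PosDom.truth x) :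
    Prv p (incGH (PosDom.syn x)) := by
  cases x with
  | inl a => exact AtmDom.sound a h
  | inr v => exact v.sound p h

theorem GoalDom.sound (g : GoalDom S) {p : World S} (h : p ∈ GoalDom.truth g) :
    Prv p (GoalDom.syn g) := by
  cases g with
  | inl x => exact PosDom.sound x h
  | inr v => exact v.sound p h

theorem AtmDom.up (a : AtmDom S) {p p' : World S} (hp : p.le p') (h : p ∈ AtmDom.truth a) :
    p' ∈ AtmDom.truth a := by
  cases a with
  | inl r => exact Prv.mono h hp
  | inr v => exact v.up _ _ hp h

theorem PosDom.up (x : PosDom S) {p p' : World S} (hp : p.le p') (h : p ∈ PosDom.truth x) :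
    p' ∈ PosDom.truth x := by
  cases x with
  | inl a => exact AtmDom.up a hp h
  | inr v => exact v.up _ _ hp h

theorem GoalDom.up (g : GoalDom S) {p p' : World S} (hp : p.le p') (h : p ∈ GoalDom.truth g) :
    p' ∈ GoalDom.truth g := by
  cases g with
  | inl x => exact PosDom.up x hp h
  | inr v => exact v.up _ _ hp h

/-- Function types all of whose arguments have object types. -/
def Ty.IsSyn {B : Type u} : Ty B → Prop
  | .arr α β => α.IsObj ∧ β.IsSyn
  | _ => True

theorem Ty.IsObj.isSyn {B : Type u} : {α : Ty B} → α.IsObj → α.IsSyn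
  | .arr _ _, h => ⟨h.1, h.2.isSyn⟩
  | .ind, _ => trivial
  | .base _, _ => trivial
  | .atm, _ => trivial
  | .pos, _ => trivial
  | .rig, _ => trivial
  | .goal, _ => trivial
  | .prog, _ => trivial

theorem Ty.IsRigid.isSyn {B : Type u} : {α : Ty B} → α.IsRigid → α.IsSyn
  | .arr _ _, h => ⟨h.1, h.2.isSyn⟩
  | .ind, _ => trivial
  | .base _, _ => trivial
  | .atm, _ => trivial
  | .pos, _ => trivial
  | .rig, _ => trivial
  | .goal, _ => trivial
  | .prog, _ => trivial

/-- The domains, with the relation that a closed term tracks an element. -/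
def DomTr (S : Sig.{u}) : (τ : Ty S.Base) → (X : Type u) × (Term S [] τ → X → Prop)
  | .ind => ⟨Term S [] .ind, Conv⟩
  | .base b => ⟨Term S [] (.base b), Conv⟩
  | .rig => ⟨Term S [] .rig, Conv⟩
  | .atm => ⟨AtmDom S, fun t a => Conv t (AtmDom.syn a)⟩
  | .pos => ⟨PosDom S, fun t a => Conv t (PosDom.syn a)⟩
  | .goal => ⟨GoalDom S, fun t a => Conv t (GoalDom.syn a)⟩
  -- The formal neutral element `none` is tracked by no term. This is why `IsSyn` exempts functions
  -- with program arguments from having a tracking term.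
  | .prog => ⟨World S, fun t p => ∃ D, p = some D ∧ Conv t D⟩
  | .arr σ τ =>
    ⟨{f : (DomTr S σ).1 → (DomTr S τ).1 // (σ ⇒ₜ τ).IsSyn → ∃ t : Term S [] (σ ⇒ₜ τ),
        ∀ s d, (DomTr S σ).2 s d → (DomTr S τ).2 (.app t s) (f d)},
      fun t f => ∀ s d, (DomTr S σ).2 s d → (DomTr S τ).2 (.app t s) (f.1 d)⟩

/-- The domain of a type. -/
def Dom (S : Sig.{u}) (τ : Ty S.Base) : Type u := (DomTr S τ).1

/-- A closed term tracks an element. -/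
def Tr {τ : Ty S.Base} (t : Term S [] τ) (d : Dom S τ) : Prop := (DomTr S τ).2 t d

/-- Application. -/
def Dom.app {σ τ : Ty S.Base} (f : Dom S (σ ⇒ₜ τ)) (d : Dom S σ) : Dom S τ := Subtype.val f d

/-- Functions, with a tracking term where there has to be one. -/
def Dom.mk {σ τ : Ty S.Base} (f : Dom S σ → Dom S τ)
    (h : (σ ⇒ₜ τ).IsSyn → ∃ t : Term S [] (σ ⇒ₜ τ), ∀ s d, Tr s d → Tr (.app t s) (f d)) :
    Dom S (σ ⇒ₜ τ) := Subtype.mk f h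

theorem Dom.exists_tr_arr {σ τ : Ty S.Base} (h : (σ ⇒ₜ τ).IsSyn) (f : Dom S (σ ⇒ₜ τ)) :
    ∃ t, Tr t f := Subtype.property f h

theorem Dom.ext {σ τ : Ty S.Base} {f f' : Dom S (σ ⇒ₜ τ)} (h : ∀ d, f.app d = f'.app d) :
    f = f' := Subtype.ext (funext h)

theorem Tr.app {σ τ : Ty S.Base} {t : Term S [] (σ ⇒ₜ τ)} {f : Dom S (σ ⇒ₜ τ)}
    {s : Term S [] σ} {d : Dom S σ} (h : Tr t f) (h' : Tr s d) : Tr (.app t s) (f.app d) := h s d h'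

/-- Quantifiers range over object types, so every instance considered in the model comes with a term
that can serve as a witness. -/
theorem Dom.exists_tr : {α : Ty S.Base} → α.IsObj → (d : Dom S α) → ∃ t, Tr t d
  | .arr _ _, h, d => d.exists_tr_arr ⟨h.1, h.2.isSyn⟩
  | .ind, _, d => ⟨d, Conv.refl _⟩
  | .base _, _, d => ⟨d, Conv.refl _⟩
  | .atm, _, d => ⟨AtmDom.syn d, Conv.refl _⟩
  | .pos, _, d => ⟨PosDom.syn d, Conv.refl _⟩
  | .rig, h, _ => h.elim
  | .goal, h, _ => h.elim
  | .prog, h, _ => h.elim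

theorem Tr.conv : {τ : Ty S.Base} → {t t' : Term S [] τ} → {d : Dom S τ} →
    Conv t t' → Tr t d → Tr t' d
  | .arr _ _, _, _, _, h, ht => fun s d hs => (Tr.conv (.app h (.refl s)) (ht s d hs) :)
  | .ind, _, _, _, h, ht => h.symm.trans ht
  | .base _, _, _, _, h, ht => h.symm.trans ht
  | .atm, _, _, _, h, ht => h.symm.trans ht
  | .pos, _, _, _, h, ht => h.symm.trans ht
  | .rig, _, _, _, h, ht => h.symm.trans ht
  | .goal, _, _, _, h, ht => h.symm.trans ht
  | .prog, _, _, _, h, ht =>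
    match ht with
    | ⟨D, e, hD⟩ => ⟨D, e, h.symm.trans hD⟩

theorem exists_fresh_con (S : Sig.{u}) {α : Ty S.Base} (hα : α.IsObj) (i : ℕ) {U : Set (Sym S)}
    (hU : U.Finite) : ∃ c : S.Con i α, Sym.con i α c ∉ U := by
  have := S.con_infinite i α (.inl hα)
  have hi : Function.Injective fun c : S.Con i α => Sym.con i α c := by
    intro c c' h
    cases h
    rfl
  obtain ⟨c, hc⟩ := (hU.preimage hi.injOn).exists_notMem
  exact ⟨c, hc⟩

/-- Existence and uniqueness depend on each other. A function tracked by `t` is defined by applying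
`t` to a chosen term for each argument, the choice being harmless by uniqueness at the argument
type. Uniqueness at a function type is tested on a fresh constant, which tracks some argument by
existence. -/
theorem tr_exists_unique_aux : (τ : Ty S.Base) → τ.IsSyn →
    (∀ t : Term S [] τ, ∃ d : Dom S τ, Tr t d) ∧
    ∀ (t t' : Term S [] τ) (d : Dom S τ), Tr t d → Tr t' d → Conv t t'
  | .ind, _ => ⟨fun t => ⟨t, Conv.refl t⟩, fun _ _ _ h h' => Conv.trans h (Conv.symm h')⟩
  | .base _, _ => ⟨fun t => ⟨t, Conv.refl t⟩, fun _ _ _ h h' => Conv.trans h (Conv.symm h')⟩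
  | .rig, _ => ⟨fun t => ⟨t, Conv.refl t⟩, fun _ _ _ h h' => Conv.trans h (Conv.symm h')⟩
  -- The empty truth set is vacuously sound, so every formula underlies some value.
  | .atm, _ => ⟨fun t => ⟨.inr ⟨t, ∅, by simp, by simp⟩, Conv.refl t⟩,
      fun _ _ _ h h' => Conv.trans h (Conv.symm h')⟩
  | .pos, _ => ⟨fun t => ⟨.inr ⟨t, ∅, by simp, by simp⟩, Conv.refl t⟩,
      fun _ _ _ h h' => Conv.trans h (Conv.symm h')⟩
  | .goal, _ => ⟨fun t => ⟨.inr ⟨t, ∅, by simp, by simp⟩, Conv.refl t⟩,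
      fun _ _ _ h h' => Conv.trans h (Conv.symm h')⟩
  | .prog, _ => ⟨fun t => ⟨some t, t, rfl, Conv.refl t⟩, by
      rintro t t' d ⟨D, rfl, h⟩ ⟨D', e, h'⟩
      cases e
      exact h.trans h'.symm⟩
  | .arr α β, h => by
    obtain ⟨ihα, ihα'⟩ := tr_exists_unique_aux α h.1.isSyn
    obtain ⟨ihβ, ihβ'⟩ := tr_exists_unique_aux β h.2
    refine ⟨fun t => ?_, fun t t' f ht ht' => ?_⟩
    · choose tr htr using fun d : Dom S α => Dom.exists_tr h.1 d
      choose F hF using ihβ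
      have key : ∀ s d, Tr s d → Tr (.app t s) (F (.app t (tr d))) := fun s d hs =>
        Tr.conv (.app (.refl t) (ihα' _ _ _ (htr d) hs)) (hF _)
      exact ⟨Dom.mk (fun d => F (.app t (tr d))) fun _ => ⟨t, key⟩, key⟩
    · obtain ⟨c, hc⟩ := exists_fresh_con S h.1 0 (t.syms_finite.union t'.syms_finite)
      obtain ⟨d, hd⟩ := ihα (con c)
      exact Conv.of_fresh h.1 c (fun h => hc (.inl h)) (fun h => hc (.inr h))
        (ihβ' _ _ _ (ht.app hd) (ht'.app hd))

/-- Every closed term tracks some element. -/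
theorem exists_dom {τ : Ty S.Base} (h : τ.IsSyn) (t : Term S [] τ) : ∃ d : Dom S τ, Tr t d :=
  (tr_exists_unique_aux τ h).1 t

/-- The term tracking an element is unique up to conversion. -/
theorem Tr.unique {τ : Ty S.Base} (h : τ.IsSyn) {t t' : Term S [] τ} {d : Dom S τ}
    (ht : Tr t d) (ht' : Tr t' d) : Conv t t' :=
  (tr_exists_unique_aux τ h).2 t t' d ht ht'

/-! ## The logical operations of the term model -/

/-- A tracking term of a function. -/
noncomputable def trk {σ τ : Ty S.Base} (f : Dom S (σ ⇒ₜ τ)) (h : (σ ⇒ₜ τ).IsSyn) :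
    Term S [] (σ ⇒ₜ τ) := (f.exists_tr_arr h).choose

theorem tr_trk {σ τ : Ty S.Base} (f : Dom S (σ ⇒ₜ τ)) (h : (σ ⇒ₜ τ).IsSyn) : Tr (trk f h) f :=
  (f.exists_tr_arr h).choose_spec

theorem Tr.conv_trk {σ τ : Ty S.Base} {f : Dom S (σ ⇒ₜ τ)} {t : Term S [] (σ ⇒ₜ τ)} (ht : Tr t f)
    (h : (σ ⇒ₜ τ).IsSyn) : Conv t (trk f h) := Tr.unique h ht (tr_trk f h)

/-- The goal-valued function obtained from one with values in the positive formulae. -/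
def liftPos {α : Ty S.Base} (h : α.IsObj) (t : Term S [] (α ⇒ₜ .pos)) : Term S [] (α ⇒ₜ .goal) :=
  lam h (incGH (etaBody h t))

theorem liftPos_app {α : Ty S.Base} (h : α.IsObj) (t : Term S [] (α ⇒ₜ .pos)) (s : Term S [] α) :
    Conv (.app (liftPos h t) s) (incGH (.app t s)) := by
  have := Conv.beta h (incGH (etaBody h t)) s
  rwa [show (incGH (etaBody h t)).inst s = incGH ((etaBody h t).inst s) from rfl,
    etaBody_inst] at this

theorem conv_sig {α : Ty S.Base} (h : α.IsObj) (t : Term S [] (α ⇒ₜ .pos)) :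
    Conv (incGH (.app (log (.sigH h)) t)) (.app (log (.sigG h)) (liftPos h t)) :=
  (Conv.incGH (.app (.refl _) (Conv.eta h t).symm)).trans (Conv.inc_sig h _)

theorem conv_pi {α : Ty S.Base} (h : α.IsObj) (t : Term S [] (α ⇒ₜ .pos)) :
    Conv (incGH (.app (log (.piH h)) t)) (.app (log (.piG h)) (liftPos h t)) :=
  (Conv.incGH (.app (.refl _) (Conv.eta h t).symm)).trans (Conv.inc_pi h _)

/-- Truth. -/
def posTop : PosDom S :=
  .inr ⟨log .topH, Set.univ, fun p _ => .conv Conv.inc_top.symm (.top p), fun _ _ _ _ => trivial⟩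

/-- Conjunction. -/
def posAnd (x y : PosDom S) : PosDom S :=
  .inr ⟨op2 .andH x.syn y.syn, x.truth ∩ y.truth,
    fun _ h => .conv (Conv.inc_and _ _).symm (.and (x.sound h.1) (y.sound h.2)),
    fun _ _ hp h => ⟨x.up hp h.1, y.up hp h.2⟩⟩

/-- Disjunction. -/
def posOr (x y : PosDom S) : PosDom S :=
  .inr ⟨op2 .orH x.syn y.syn, x.truth ∪ y.truth,
    fun _ h => .conv (Conv.inc_or _ _).symm
      (h.elim (fun h => .orL _ (x.sound h)) (fun h => .orR _ (y.sound h))),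
    fun _ _ hp h => h.imp (x.up hp) (y.up hp)⟩

/-- The programs proving some instance. -/
def posSigTruth {α : Ty S.Base} (f : Dom S (α ⇒ₜ .pos)) : Set (World S) :=
  {p | ∃ d, p ∈ PosDom.truth (f.app d)}

/-- The programs proving all instances. -/
def posPiTruth {α : Ty S.Base} (f : Dom S (α ⇒ₜ .pos)) : Set (World S) :=
  {p | ∀ d, p ∈ PosDom.truth (f.app d)}

/-- Existential quantification. -/
noncomputable def posSig {α : Ty S.Base} (h : α.IsObj) (f : Dom S (α ⇒ₜ .pos)) : PosDom S :=
  .inr ⟨.app (log (.sigH h)) (trk f ⟨h, trivial⟩), posSigTruth f, by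
    rintro p ⟨d, hd⟩
    obtain ⟨s, hs⟩ := d.exists_tr h
    refine .conv (conv_sig h _).symm (.sig h s (.conv (liftPos_app h _ s).symm ?_))
    exact .conv (Conv.incGH (Conv.symm ((tr_trk f ⟨h, trivial⟩).app hs)))
      (PosDom.sound (f.app d) hd),
    fun _ _ hp ⟨d, hd⟩ => ⟨d, PosDom.up (f.app d) hp hd⟩⟩

/-- Universal quantification. -/
noncomputable def posPi {α : Ty S.Base} (h : α.IsObj) (f : Dom S (α ⇒ₜ .pos)) : PosDom S :=
  .inr ⟨.app (log (.piH h)) (trk f ⟨h, trivial⟩), posPiTruth f, by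
    intro p hp
    refine .conv (conv_pi h _).symm (.pi h fun i c => .conv (liftPos_app h _ _).symm ?_)
    -- The rule `Prv.pi` asks only for instances at constants, and each constant tracks an element
    -- of the domain.
    obtain ⟨d, hd⟩ := exists_dom h.isSyn (con (S := S) c)
    exact .conv (Conv.incGH (Conv.symm ((tr_trk f ⟨h, trivial⟩).app hd)))
      (PosDom.sound (f.app d) (hp d)),
    fun _ _ hp h d => PosDom.up (f.app d) hp (h d)⟩

/-- Conjunction. -/
def goalAnd : GoalDom S → GoalDom S → GoalDom S
  -- The inclusion of positive formulae must commute with conjunction as an equality of elements, so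
  -- included values have to stay in the left summand.
  | .inl x, .inl y => .inl (posAnd x y)
  | g, g' => .inr ⟨op2 .andG g.syn g'.syn, g.truth ∩ g'.truth,
    fun _ h => .and (g.sound h.1) (g'.sound h.2),
    fun _ _ hp h => ⟨g.up hp h.1, g'.up hp h.2⟩⟩

/-- Disjunction. -/
def goalOr : GoalDom S → GoalDom S → GoalDom S
  | .inl x, .inl y => .inl (posOr x y)
  | g, g' => .inr ⟨op2 .orG g.syn g'.syn, g.truth ∪ g'.truth,
    fun _ h => h.elim (fun h => .orL _ (g.sound h)) (fun h => .orR _ (g'.sound h)),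
    fun _ _ hp h => h.imp (g.up hp) (g'.up hp)⟩

theorem goalAnd_truth (g g' : GoalDom S) :
    GoalDom.truth (goalAnd g g') = GoalDom.truth g ∩ GoalDom.truth g' := by
  cases g <;> cases g' <;> rfl

theorem goalOr_truth (g g' : GoalDom S) :
    GoalDom.truth (goalOr g g') = GoalDom.truth g ∪ GoalDom.truth g' := by
  cases g <;> cases g' <;> rfl

theorem goalAnd_syn (g g' : GoalDom S) :
    Conv (op2 .andG (GoalDom.syn g) (GoalDom.syn g')) (GoalDom.syn (goalAnd g g')) := by
  cases g <;> cases g' <;> first | exact .refl _ | exact (Conv.inc_and _ _).symm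

theorem goalOr_syn (g g' : GoalDom S) :
    Conv (op2 .orG (GoalDom.syn g) (GoalDom.syn g')) (GoalDom.syn (goalOr g g')) := by
  cases g <;> cases g' <;> first | exact .refl _ | exact (Conv.inc_or _ _).symm

/-- Implication. -/
def goalImp : World S → GoalDom S → GoalDom S
  -- No formula expresses implication from the formal neutral element; since `p.and none = p`, the
  -- goal itself has the right truth set.
  | none, g => g
  | some D, g => .inr ⟨op2 .impG D g.syn, {p | p.and (some D) ∈ g.truth},
    fun _ h => .imp (g.sound h), fun _ _ hp h => g.up (World.le_and hp _) h⟩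

theorem mem_goalImp_truth (q : World S) (g : GoalDom S) (p : World S) :
    p ∈ GoalDom.truth (goalImp q g) ↔ p.and q ∈ GoalDom.truth g := by
  cases q with
  | none => rw [World.and_none]; rfl
  | some D => rfl

/-- The programs proving some instance. -/
def goalSigTruth {α : Ty S.Base} (f : Dom S (α ⇒ₜ .goal)) : Set (World S) :=
  {p | ∃ d, p ∈ GoalDom.truth (f.app d)}

/-- The programs proving all instances. -/
def goalPiTruth {α : Ty S.Base} (f : Dom S (α ⇒ₜ .goal)) : Set (World S) :=
  {p | ∀ d, p ∈ GoalDom.truth (f.app d)}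

/-- All values of `f` are positive formulae, given by `f'`. -/
def IsPosFun {α : Ty S.Base} (f : Dom S (α ⇒ₜ .goal)) (f' : Dom S (α ⇒ₜ .pos)) : Prop :=
  ∀ d, (f.app d : GoalDom S) = Sum.inl (f'.app d)

open Classical in
/-- Existential quantification. -/
noncomputable def goalSig {α : Ty S.Base} (h : α.IsObj) (f : Dom S (α ⇒ₜ .goal)) : GoalDom S :=
  -- `incGH_sig` forces a function that factors through the positive values to be quantified there;
  -- the factor is unique by `IsPosFun.unique`.
  if e : ∃ f', IsPosFun f f' then .inl (posSig h e.choose) else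
  .inr ⟨.app (log (.sigG h)) (trk f ⟨h, trivial⟩), goalSigTruth f, by
    rintro p ⟨d, hd⟩
    obtain ⟨s, hs⟩ := d.exists_tr h
    exact .sig h s (.conv (Conv.symm ((tr_trk f ⟨h, trivial⟩).app hs))
      (GoalDom.sound (f.app d) hd)),
    fun _ _ hp ⟨d, hd⟩ => ⟨d, GoalDom.up (f.app d) hp hd⟩⟩

open Classical in
/-- Universal quantification. -/
noncomputable def goalPi {α : Ty S.Base} (h : α.IsObj) (f : Dom S (α ⇒ₜ .goal)) : GoalDom S :=
  if e : ∃ f', IsPosFun f f' then .inl (posPi h e.choose) else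
  .inr ⟨.app (log (.piG h)) (trk f ⟨h, trivial⟩), goalPiTruth f, by
    intro p hp
    refine .pi h fun i c => ?_
    obtain ⟨d, hd⟩ := exists_dom h.isSyn (con (S := S) c)
    exact .conv (Conv.symm ((tr_trk f ⟨h, trivial⟩).app hd)) (GoalDom.sound (f.app d) (hp d)),
    fun _ _ hp h d => GoalDom.up (f.app d) hp (h d)⟩

theorem IsPosFun.unique {α : Ty S.Base} {f : Dom S (α ⇒ₜ .goal)} {f₁ f₂ : Dom S (α ⇒ₜ .pos)}
    (h₁ : IsPosFun f f₁) (h₂ : IsPosFun f f₂) : f₁ = f₂ :=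
  Dom.ext fun d => Sum.inl_injective ((h₁ d).symm.trans (h₂ d))

/-- The lifted tracking term of `f'` tracks `f` as well, so uniqueness of tracking terms applies.
Hence choosing the positive quantifier does not change the underlying goal up to conversion. -/
theorem IsPosFun.conv {α : Ty S.Base} (h : α.IsObj) {f : Dom S (α ⇒ₜ .goal)}
    {f' : Dom S (α ⇒ₜ .pos)} (hf : IsPosFun f f') {t : Term S [] (α ⇒ₜ .goal)} (ht : Tr t f) :
    Conv t (liftPos h (trk f' ⟨h, trivial⟩)) := by
  refine Tr.unique (τ := α ⇒ₜ .goal) (d := f) ⟨h, trivial⟩ ht fun s d hs => ?_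
  change Conv _ (GoalDom.syn (f.app d))
  rw [hf d]
  exact (liftPos_app h _ s).trans (Conv.incGH ((tr_trk f' ⟨h, trivial⟩).app hs))

theorem goalSig_pos {α : Ty S.Base} (h : α.IsObj) {f : Dom S (α ⇒ₜ .goal)}
    {f' : Dom S (α ⇒ₜ .pos)} (hf : IsPosFun f f') : goalSig h f = .inl (posSig h f') := by
  have e : ∃ f', IsPosFun f f' := ⟨f', hf⟩
  rw [goalSig, dif_pos e, e.choose_spec.unique hf]

theorem goalPi_pos {α : Ty S.Base} (h : α.IsObj) {f : Dom S (α ⇒ₜ .goal)}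
    {f' : Dom S (α ⇒ₜ .pos)} (hf : IsPosFun f f') : goalPi h f = .inl (posPi h f') := by
  have e : ∃ f', IsPosFun f f' := ⟨f', hf⟩
  rw [goalPi, dif_pos e, e.choose_spec.unique hf]

/-- The case distinction affects the syntactic component only: both branches take the union over all
instances. -/
theorem goalSig_truth {α : Ty S.Base} (h : α.IsObj) (f : Dom S (α ⇒ₜ .goal)) :
    GoalDom.truth (goalSig h f) = goalSigTruth f := by
  by_cases e : ∃ f', IsPosFun f f'
  · obtain ⟨f', hf⟩ := e
    rw [goalSig_pos h hf]
    ext p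
    refine exists_congr fun d => ?_
    rw [hf d]
    rfl
  · rw [goalSig, dif_neg e]
    rfl

theorem goalPi_truth {α : Ty S.Base} (h : α.IsObj) (f : Dom S (α ⇒ₜ .goal)) :
    GoalDom.truth (goalPi h f) = goalPiTruth f := by
  by_cases e : ∃ f', IsPosFun f f'
  · obtain ⟨f', hf⟩ := e
    rw [goalPi_pos h hf]
    ext p
    refine forall_congr' fun d => ?_
    rw [hf d]
    rfl
  · rw [goalPi, dif_neg e]
    rfl

theorem goalSig_syn {α : Ty S.Base} (h : α.IsObj) {f : Dom S (α ⇒ₜ .goal)}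
    {t : Term S [] (α ⇒ₜ .goal)} (ht : Tr t f) :
    Conv (.app (log (.sigG h)) t) (GoalDom.syn (goalSig h f)) := by
  by_cases e : ∃ f', IsPosFun f f'
  · obtain ⟨f', hf⟩ := e
    rw [goalSig_pos h hf]
    exact (Conv.app (.refl _) (hf.conv h ht)).trans (conv_sig h _).symm
  · rw [goalSig, dif_neg e]
    exact .app (.refl _) (ht.conv_trk _)

theorem goalPi_syn {α : Ty S.Base} (h : α.IsObj) {f : Dom S (α ⇒ₜ .goal)}
    {t : Term S [] (α ⇒ₜ .goal)} (ht : Tr t f) :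
    Conv (.app (log (.piG h)) t) (GoalDom.syn (goalPi h f)) := by
  by_cases e : ∃ f', IsPosFun f f'
  · obtain ⟨f', hf⟩ := e
    rw [goalPi_pos h hf]
    exact (Conv.app (.refl _) (hf.conv h ht)).trans (conv_pi h _).symm
  · rw [goalPi, dif_neg e]
    exact .app (.refl _) (ht.conv_trk _)

/-- Clauses. -/
def progImp (g : GoalDom S) (r : Term S [] .rig) : World S :=
  some (op2 .impP (GoalDom.syn g) r)

/-- Universal quantification of programs. -/
noncomputable def progPi {α : Ty S.Base} (h : α.IsObj) (f : Dom S (α ⇒ₜ .prog)) : World S :=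
  some (.app (log (.piP h)) (trk f ⟨h, trivial⟩))

/-- If `s` tracks `d`, the program `f.app d` is convertible to the tracking term of `f` applied to
`s`, which reduces the claim to `Inst.pi`. -/
theorem le_progPi {α : Ty S.Base} (h : α.IsObj) (f : Dom S (α ⇒ₜ .prog)) (d : Dom S α) :
    World.le (f.app d) (progPi h f) := by
  intro G A hi
  obtain ⟨s, hs⟩ := d.exists_tr h
  obtain ⟨D, hD, hc⟩ := (tr_trk f ⟨h, trivial⟩).app hs
  rw [hD] at hi
  exact Inst.pi h (Inst.conv (Conv.symm hc) hi)

/-- Curried binary operations. -/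
def Dom.mk₂ {α β γ : Ty S.Base} (c : Term S [] (α ⇒ₜ β ⇒ₜ γ)) (op : Dom S α → Dom S β → Dom S γ)
    (h : ∀ s d s' d', Tr s d → Tr s' d' → Tr (.app (.app c s) s') (op d d'))
    -- A partial application needs a tracking term only if the second argument has an object type;
    -- among the binary logical constants these are `andH` and `orH`.
    (he : (β ⇒ₜ γ).IsSyn → ∀ d : Dom S α, ∃ s, Tr s d) : Dom S (α ⇒ₜ β ⇒ₜ γ) :=
  Dom.mk (fun d => Dom.mk (op d) fun hs => (he hs d).elim fun s hd =>
      ⟨.app c s, fun s' d' => h s d s' d' hd⟩)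
    fun _ => ⟨c, fun s d hd s' d' hd' => h s d s' d' hd hd'⟩

/-- Tracked operations. -/
def Dom.mk₁ {α β : Ty S.Base} (c : Term S [] (α ⇒ₜ β)) (op : Dom S α → Dom S β)
    (h : ∀ s d, Tr s d → Tr (.app c s) (op d)) : Dom S (α ⇒ₜ β) :=
  Dom.mk op fun _ => ⟨c, h⟩

theorem Dom.tr_mk₁ {α β : Ty S.Base} (c : Term S [] (α ⇒ₜ β)) (op : Dom S α → Dom S β)
    (h : ∀ s d, Tr s d → Tr (.app c s) (op d)) : Tr c (Dom.mk₁ c op h) := h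

/-- The interpretation of the logical constants. -/
noncomputable def logDom : {τ : Ty S.Base} → Log τ → Dom S τ
  -- `incGH_top` requires truth among goals to be the included truth of positive formulae.
  | _, .topG => (Sum.inl posTop : GoalDom S)
  | _, .topH => (posTop : PosDom S)
  | _, .andP => Dom.mk₂ (log .andP) (World.and (S := S)) (by
      rintro s _ s' _ ⟨D, rfl, h⟩ ⟨D', rfl, h'⟩
      exact ⟨_, rfl, Conv.app (.app (.refl _) h) h'⟩) (fun h => h.1.elim)
  | _, .andG => Dom.mk₂ (log .andG) (goalAnd (S := S)) (fun _ g _ g' h h' =>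
      (Conv.app (.app (.refl _) h) h').trans (goalAnd_syn g g')) (fun h => h.1.elim)
  | _, .andH => Dom.mk₂ (log .andH) (posAnd (S := S)) (fun _ _ _ _ h h' =>
      Conv.app (.app (.refl _) h) h') (fun _ d => Dom.exists_tr (α := .pos) trivial d)
  | _, .orG => Dom.mk₂ (log .orG) (goalOr (S := S)) (fun _ g _ g' h h' =>
      (Conv.app (.app (.refl _) h) h').trans (goalOr_syn g g')) (fun h => h.1.elim)
  | _, .orH => Dom.mk₂ (log .orH) (posOr (S := S)) (fun _ _ _ _ h h' =>
      Conv.app (.app (.refl _) h) h') (fun _ d => Dom.exists_tr (α := .pos) trivial d)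
  | _, .impG => Dom.mk₂ (log .impG) (goalImp (S := S)) (by
      rintro s _ s' g ⟨D, rfl, h⟩ h'
      exact Conv.app (.app (.refl _) h) h') (fun h => h.1.elim)
  | _, .impP => Dom.mk₂ (log .impP) (progImp (S := S)) (fun _ _ _ _ h h' =>
      ⟨_, rfl, Conv.app (.app (.refl _) h) h'⟩) (fun h => h.1.elim)
  | _, .sigG h => Dom.mk₁ (log (.sigG h)) (goalSig h) fun _ _ ht => goalSig_syn h ht
  | _, .piG h => Dom.mk₁ (log (.piG h)) (goalPi h) fun _ _ ht => goalPi_syn h ht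
  | _, .sigH (α := α) h => Dom.mk₁ (log (.sigH h)) (posSig h) fun _ f ht =>
      Conv.app (.refl _) (ht.conv_trk _)
  | _, .piH (α := α) h => Dom.mk₁ (log (.piH h)) (posPi h) fun _ f ht =>
      Conv.app (.refl _) (ht.conv_trk _)
  | _, .piP (α := α) h => Dom.mk₁ (log (.piP h)) (progPi h) fun _ f ht => ⟨_, rfl,
      .app (.refl _) (ht.conv_trk _)⟩

theorem tr_logDom {τ : Ty S.Base} (c : Log τ) : Tr (log (S := S) c) (logDom c) := by
  cases c with
  | topG => exact Conv.inc_top.symm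
  | topH => exact Conv.refl _
  | sigG h => exact Dom.tr_mk₁ (log (.sigG h)) (goalSig h) fun _ _ ht => goalSig_syn h ht
  | piG h => exact Dom.tr_mk₁ (log (.piG h)) (goalPi h) fun _ _ ht => goalPi_syn h ht
  | sigH h => exact Dom.tr_mk₁ (log (.sigH h)) (posSig h) fun _ f ht => Conv.app (.refl _) (ht.conv_trk _)
  | piH h => exact Dom.tr_mk₁ (log (.piH h)) (posPi h) fun _ f ht => Conv.app (.refl _) (ht.conv_trk _)
  | piP h => exact Dom.tr_mk₁ (log (.piP h)) (progPi h) fun _ f ht => ⟨_, rfl, Conv.app (.refl _) (ht.conv_trk _)⟩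
  | andP =>
    rintro s _ ⟨D, rfl, h⟩ s' _ ⟨D', rfl, h'⟩
    exact ⟨_, rfl, Conv.app (.app (.refl _) h) h'⟩
  | impG =>
    rintro s _ ⟨D, rfl, h⟩ s' g h'
    exact Conv.app (.app (.refl _) h) h'
  | impP => exact fun _ _ h _ _ h' => ⟨_, rfl, Conv.app (.app (.refl _) h) h'⟩
  | andG => exact fun _ g h _ g' h' => (Conv.app (.app (.refl _) h) h').trans (goalAnd_syn g g')
  | orG => exact fun _ g h _ g' h' => (Conv.app (.app (.refl _) h) h').trans (goalOr_syn g g')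
  | andH | orH => exact fun _ _ h _ _ h' => Conv.app (.app (.refl _) h) h'

/-! ## The term model -/

theorem Sig.con_isSyn {i : ℕ} {α : Ty S.Base} (c : S.Con i α) : α.IsSyn :=
  (S.con_type i α c).elim (·.isSyn) (·.isSyn)

/-- The interpretation of the nonlogical constants. -/
noncomputable def conDom {i : ℕ} {α : Ty S.Base} (c : S.Con i α) : Dom S α :=
  (exists_dom (Sig.con_isSyn c) (con (S := S) c)).choose

theorem tr_conDom {i : ℕ} {α : Ty S.Base} (c : S.Con i α) : Tr (con (S := S) c) (conDom c) :=
  (exists_dom (Sig.con_isSyn c) (con (S := S) c)).choose_spec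

/-- Extension of an environment. -/
def consDom {Γ : List (Ty S.Base)} {β : Ty S.Base} (ρ : ∀ α, Var Γ α → Dom S α) (d : Dom S β) :
    ∀ α, Var (β :: Γ) α → Dom S α
  | _, .zero _ => d
  | _, .succ x => ρ _ x

theorem gsub_lift_inst {Γ Δ : List (Ty S.Base)} {β τ : Ty S.Base} (t : Term S (β :: Γ) τ)
    (ς : GSub S Γ Δ) (s : Term S Δ β) :
    (t.gsub ς.lift).inst s = t.gsub ⟨consSub ς.b s, ς.f, ς.k⟩ := by
  rw [inst, bsubst_eq_gsub, gsub_gsub]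
  have hw : ∀ {α : Ty S.Base} (t : Term S Δ α), t.weaken.gsub (.ofB (instSub s)) = t := by
    intro α t
    rw [← bsubst_eq_gsub]
    exact weaken_inst t s
  congr 1
  ext α x
  · cases x with
    | zero => rfl
    | succ x => exact hw _
  · exact hw _
  · exact hw _

/-- The interpretation of terms, together with its tracking property. -/
noncomputable def evalTr : {Γ : List (Ty S.Base)} → {τ : Ty S.Base} → (t : Term S Γ τ) →
    (φ : ∀ α, FVar α → Dom S α) → (ρ : ∀ α, Var Γ α → Dom S α) →
    {d : Dom S τ // ∀ σ ψ, (∀ α x, Tr (σ α x) (ρ α x)) → (∀ α x, Tr (ψ α x) (φ α x)) →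
      Tr (t.gsub ⟨σ, ψ, fun _ _ c => con c⟩) d}
  | _, _, bvar x, _, ρ => ⟨ρ _ x, fun _ _ h _ => h _ x⟩
  | _, _, fvar x, φ, _ => ⟨φ _ x, fun _ _ _ h => h _ x⟩
  | _, _, con c, _, _ => ⟨conDom c, fun _ _ _ _ => tr_conDom c⟩
  | _, _, log c, _, _ => ⟨logDom c, fun _ _ _ _ => tr_logDom c⟩
  | _, _, app s t, φ, ρ => ⟨(evalTr s φ ρ).1.app (evalTr t φ ρ).1, fun σ ψ h h' =>
      ((evalTr s φ ρ).2 σ ψ h h').app ((evalTr t φ ρ).2 σ ψ h h')⟩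
  | Γ, _, lam (α := α) (β := β) hα t, φ, ρ =>
    have key : ∀ σ ψ, (∀ α x, Tr (σ α x) (ρ α x)) → (∀ α x, Tr (ψ α x) (φ α x)) →
        ∀ s d, Tr s d → Tr (.app ((lam hα t).gsub ⟨σ, ψ, fun _ _ c => con c⟩) s)
          (evalTr t φ (consDom ρ d)).1 := fun σ ψ h h' s d hd => by
      refine Tr.conv (Conv.beta hα _ s).symm ?_
      rw [gsub_lift_inst]
      refine (evalTr t φ (consDom ρ d)).2 _ _ (fun α x => ?_) h'
      cases x with
      | zero => exact hd
      | succ x => exact h _ x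
    -- Membership in the function domain needs some tracking term, which is why values and tracking
    -- are constructed together. It is built from terms tracking the values of the variables; these
    -- exist because variables have object types.
    ⟨Dom.mk (fun d => (evalTr t φ (consDom ρ d)).1) fun _ => ⟨_, key
        (fun _ x => ((ρ _ x).exists_tr x.isObj).choose)
        (fun _ x => ((φ _ x).exists_tr x.obj).choose)
        (fun _ x => ((ρ _ x).exists_tr x.isObj).choose_spec)
        (fun _ x => ((φ _ x).exists_tr x.obj).choose_spec)⟩, key⟩
  | _, _, incAR t, φ, ρ => ⟨(Sum.inl (evalTr t φ ρ).1 : AtmDom S), fun σ ψ h h' =>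
      Conv.incAR ((evalTr t φ ρ).2 σ ψ h h')⟩
  | _, _, incHA t, φ, ρ => ⟨(Sum.inl (evalTr t φ ρ).1 : PosDom S), fun σ ψ h h' =>
      Conv.incHA ((evalTr t φ ρ).2 σ ψ h h')⟩
  | _, _, incPR t, φ, ρ => ⟨(some (incPR (evalTr t φ ρ).1) : World S), fun σ ψ h h' =>
      ⟨_, rfl, Conv.incPR ((evalTr t φ ρ).2 σ ψ h h')⟩⟩
  | _, _, incGH t, φ, ρ => ⟨(Sum.inl (evalTr t φ ρ).1 : GoalDom S), fun σ ψ h h' =>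
      Conv.incGH ((evalTr t φ ρ).2 σ ψ h h')⟩

/-- The term model; its domains do not depend on the level. -/
noncomputable def termLevelled (S : Sig.{u}) : LevelledStructure S where
  D _ α := Dom S α
  app f d := f.app d
  const c := conDom c
  logConst c := logDom c
  inc _ x := x
  incAR r := (Sum.inl r : AtmDom S)
  incHA a := (Sum.inl a : PosDom S)
  incPR r := (some (incPR r) : World S)
  incGH x := (Sum.inl x : GoalDom S)
  leP p q := World.le p q
  topP _ := (none : World S)

/-- The term model as a uniform applicative structure. -/
noncomputable def termUniform (S : Sig.{u}) : UniformStructure S where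
  toLevelledStructure := termLevelled S
  ext _ _ h := Dom.ext h
  inc_self _ := rfl
  inc_inc _ _ _ := rfl
  inc_injective _ _ _ h := h
  inc_app _ _ _ := rfl
  incAR_injective _ := Sum.inl_injective
  incHA_injective _ := Sum.inl_injective
  incPR_injective _ _ _ h := by
    have := Option.some.inj h
    injection this
  incGH_injective _ := Sum.inl_injective
  inc_incAR _ _ := rfl
  inc_incHA _ _ := rfl
  inc_incPR _ _ := rfl
  inc_incGH _ _ := rfl
  incGH_top _ := rfl
  incGH_and _ _ := rfl
  incGH_or _ _ := rfl
  incGH_sig h _ _ hf := (goalSig_pos h hf).symm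
  incGH_pi h _ _ hf := (goalPi_pos h hf).symm
  leP_refl _ _ _ := id
  leP_trans _ _ _ h h' G A hi := h' G A (h G A hi)
  topP_and _ := rfl
  and_topP p := World.and_none p
  leP_and _ _ _ _ hi := World.inst_and.2 (.inl hi)
  and_comm _ _ _ _ hi := World.inst_and.2 (World.inst_and.1 hi).symm
  leP_pi h f d := le_progPi h f d

/-- The valuation of the term model. -/
noncomputable def termValuation (S : Sig.{u}) : Valuation (termUniform S) (Set PUnit.{u + 1}) where
  -- The truth values are the subsets of a point, a copy of the propositions in the required
  -- universe.
  I _ p g := {_x | p ∈ GoalDom.truth g}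
  atom _ r := Set.eq_univ_of_forall fun _ => Prv.fact (Inst.atom r)
  mono _ _ _ := le_rfl
  top _ p := Set.eq_univ_of_forall fun _ => trivial
  and _ p g g' := by
    ext
    exact Set.ext_iff.1 (goalAnd_truth g g') p
  or _ p g g' := by
    ext
    exact Set.ext_iff.1 (goalOr_truth g g') p
  imp _ p q g := by
    ext
    exact mem_goalImp_truth q g p
  sig _ p _ h f := by
    have := Set.ext_iff.1 (goalSig_truth h f) p
    constructor
    · rintro _ ⟨d, rfl⟩ _ hx
      exact this.2 ⟨d, hx⟩
    · intro U hU x hx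
      obtain ⟨d, hd⟩ := this.1 hx
      exact hU ⟨d, rfl⟩ hd
  pi _ p _ h f := by
    have := Set.ext_iff.1 (goalPi_truth h f) p
    constructor
    · rintro _ ⟨d, rfl⟩ _ hx
      exact this.1 hx d
    · intro U hU x hx
      exact this.2 fun d => hU ⟨d, rfl⟩ hx
  incl _ _ _ g hp _ h := GoalDom.up g hp h
  backchain _ _ g r hp _ h := Prv.clause (hp _ _ (Inst.imp (GoalDom.syn g) r)) (GoalDom.sound g h)

/-- The term model as a uniform algebra. -/
noncomputable def termAlgebra (S : Sig.{u}) : UniformAlgebra S where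
  toUniformStructure := termUniform S
  eval _ φ ρ t _ := (evalTr t φ ρ).1
  eval_raise _ _ _ _ _ _ := rfl
  eval_bvar _ _ _ _ _ := rfl
  eval_fvar _ _ _ _ _ := rfl
  eval_con _ _ _ _ _ _ := rfl
  eval_log _ _ _ _ _ := rfl
  eval_app _ _ _ _ _ _ _ := rfl
  eval_lam _ _ _ _ _ _ _ := rfl
  eval_incAR _ _ _ _ _ := rfl
  eval_incHA _ _ _ _ _ := rfl
  eval_incPR _ _ _ _ _ := rfl
  eval_incGH _ _ _ _ _ := rfl
  Ω := Set PUnit.{u + 1}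
  val := termValuation S

/-! ### From truth in the term model to unlabelled provability -/

theorem exists_assignment (S : Sig.{u}) :
    ∃ φ : ∀ α, FVar α → Dom S α, ∀ α (x : FVar α), Tr (fvar x) (φ α x) := by
  choose φ hφ using fun (α : Ty S.Base) (x : FVar α) => exists_dom x.obj.isSyn (fvar (S := S) x)
  exact ⟨φ, hφ⟩

/-- When each logic variable tracks its assigned value, the tracking property of `evalTr` may be
used with the identity replacement. -/
theorem tr_evalTr {τ : Ty S.Base} (t : Term S [] τ) {φ : ∀ α, FVar α → Dom S α}
    (hφ : ∀ α (x : FVar α), Tr (fvar x) (φ α x)) (ρ : ∀ α, Var [] α → Dom S α) :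
    Tr t (evalTr t φ ρ).1 := by
  have : Tr (t.gsub (.ofB fun _ x => bvar x)) (evalTr t φ ρ).1 :=
    (evalTr t φ ρ).2 _ _ (fun _ x => x.elimNil) hφ
  rwa [gsub_bvar] at this

theorem inst_foldl_and (ps : List (World S)) (p : World S) {G : Option (Term S [] .goal)}
    {A : Term S [] .rig} (h : (ps.foldl World.and p).Inst G A) :
    p.Inst G A ∨ ∃ q ∈ ps, World.Inst q G A := by
  induction ps generalizing p with
  | nil => exact .inl h
  | cons q ps ih =>
    obtain h | ⟨q', hq, h⟩ := ih _ h
    · obtain h | h := World.inst_and.1 h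
      · exact .inl h
      · exact .inr ⟨q, by simp, h⟩
    · exact .inr ⟨q', by simp [hq], h⟩

/-- Truth in the term model implies provability. -/
theorem exists_prv {i : ℕ} {P : List (Term S [] .prog)} {G : Term S [] .goal}
    (hP : ∀ D ∈ P, D.LevelLE i) (hG : G.LevelLE i)
    (htrue : ∀ (𝔄 : UniformAlgebra S) (φ : 𝔄.Assignment), 𝔄.truth i φ P G hP hG = ⊤) :
    ∃ p : World S, Prv p G ∧ ∀ G' A, p.Inst G' A → ∃ D ∈ P, Inst D G' A := by
  obtain ⟨φ, hφ⟩ := exists_assignment S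
  have h0 : (_ : Set PUnit.{u + 1}) = Set.univ := htrue (termAlgebra S) fun α x => φ α x
  have h : (termAlgebra S).evalProg i (fun α x => φ α x) P hP ∈ GoalDom.truth (evalTr G φ _).1 :=
    (Set.ext_iff.1 h0 PUnit.unit).2 trivial
  refine ⟨(termAlgebra S).evalProg i (fun α x => φ α x) P hP,
    .conv (Conv.symm (tr_evalTr G hφ _)) (GoalDom.sound _ h), fun G' A hi => ?_⟩
  have hmem : ∀ (L : List (Term S [] .prog)) (hL : ∀ D ∈ L, D.LevelLE i) (q : World S),
      q ∈ L.pmap (fun D h => (termAlgebra S).eval i (fun α x => φ α x)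
        (LevelledStructure.Env.nil _) D h) hL → q.Inst G' A → ∃ D ∈ L, Inst D G' A := by
    intro L hL q hq hi
    obtain ⟨D, hD, rfl⟩ := List.mem_pmap.1 hq
    let ρ : ∀ α, Var [] α → Dom S α := LevelledStructure.Env.nil (termLevelled S) (i := i)
    obtain ⟨D', e, hc⟩ := tr_evalTr D hφ ρ
    have hi' : World.Inst (evalTr D φ ρ).1 G' A := hi
    rw [e] at hi'
    exact ⟨D, hD, Inst.conv hc.symm hi'⟩
  cases P with
  | nil => exact hi.elim
  | cons D P =>
    obtain h | ⟨q, hq, h⟩ := inst_foldl_and _ _ hi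
    · exact hmem (D :: P) hP _ List.mem_cons_self h
    · exact hmem (D :: P) hP q (by rw [List.pmap]; exact List.mem_cons_of_mem _ hq) h

/-! ## Replacing symbols by constants -/

/-- Maps replacing logic variables and nonlogical constants by nonlogical constants. -/
structure SymMap (S : Sig.{u}) : Type u where
  f : ∀ α : Ty S.Base, FVar α → Σ j, S.Con j α
  k : ∀ (i : ℕ) (α : Ty S.Base), S.Con i α → Σ j, S.Con j α

/-- The term given by a constant. -/
def conOf {Γ : List (Ty S.Base)} {α : Ty S.Base} (c : Σ j, S.Con j α) : Term S Γ α := con c.2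

namespace SymMap

variable {Γ Δ : List (Ty S.Base)} {τ : Ty S.Base}

/-- The replacement given by a symbol map. -/
def gs (κ : SymMap S) (Γ : List (Ty S.Base)) : GSub S Γ Γ where
  b _ x := bvar x
  f α x := conOf (κ.f α x)
  k i α c := conOf (κ.k i α c)

/-- Application to terms. -/
def map (κ : SymMap S) (t : Term S Γ τ) : Term S Γ τ := t.gsub (κ.gs Γ)

/-- All labels in the range are at most `i`. -/
def LE (κ : SymMap S) (i : ℕ) : Prop :=
  (∀ α x, (κ.f α x).1 ≤ i) ∧ ∀ j α c, (κ.k j α c).1 ≤ i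

theorem gs_lift (κ : SymMap S) {β : Ty S.Base} : (κ.gs Γ).lift = κ.gs (β :: Γ) := by
  ext α x
  · cases x <;> rfl
  · rfl
  · rfl

theorem map_lam (κ : SymMap S) {α β : Ty S.Base} (h : α.IsObj) (t : Term S (α :: Γ) β) :
    κ.map (lam h t) = lam h (κ.map t) := by
  simp only [map, gsub, gs_lift]

theorem map_bsubst (κ : SymMap S) (t : Term S Γ τ) (σ : ∀ α, Var Γ α → Term S Δ α) :
    κ.map (t.bsubst σ) = (κ.map t).bsubst fun α x => κ.map (σ α x) := by
  simp only [map, bsubst_eq_gsub, gsub_gsub]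
  rfl

theorem map_conv (κ : SymMap S) {s t : Term S Γ τ} (h : Conv s t) : Conv (κ.map s) (κ.map t) :=
  h.gsub _

theorem map_closed (κ : SymMap S) (t : Term S Γ τ) : (κ.map t).Closed :=
  closed_gsub _ _ (fun _ _ _ _ h => h) (fun _ _ _ _ h => by cases h)
    (fun _ _ _ _ _ h => by cases h)

theorem map_levelLE {κ : SymMap S} {i : ℕ} (h : κ.LE i) (t : Term S Γ τ) : (κ.map t).LevelLE i :=
  levelLE_gsub _ _ (fun _ _ => trivial) h.1 h.2

theorem clauseOf_map (κ : SymMap S) {D : Term S Γ .prog} {G : Option (Term S Δ .goal)}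
    {A : Term S Δ .rig} (h : ClauseOf D Δ G A) :
    ClauseOf (κ.map D) Δ (G.map κ.map) (κ.map A) := by
  induction h with
  | atom h => exact .atom (κ.map_conv h)
  | imp h => exact .imp (κ.map_conv h)
  | andL h _ ih => exact .andL (κ.map_conv h) ih
  | andR h _ ih => exact .andR (κ.map_conv h) ih
  | all hα h _ ih =>
    refine .all hα ((κ.map_conv h).trans ?_) ih
    change Conv (Term.app (log _) (κ.map (lam hα _))) _
    rw [map_lam]
    exact .refl _

end SymMap

/-! ## Resolution -/

/-- The position of a bound variable in its context. -/
def Var.pos {B : Type u} : {Γ : List (Ty B)} → {α : Ty B} → Var Γ α → ℕ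
  | _, _, .zero _ => 0
  | _, _, .succ x => x.pos + 1

theorem Var.pos_lt {B : Type u} {Γ : List (Ty B)} {α : Ty B} (x : Var Γ α) :
    x.pos < Γ.length := by
  induction x with
  | zero => simp [pos]
  | succ x ih => simp [pos, ih]

theorem Var.eq_of_pos {B : Type u} {Γ : List (Ty B)} {α β : Ty B} (x : Var Γ α) (y : Var Γ β)
    (h : x.pos = y.pos) : (⟨α, x⟩ : Σ α, Var Γ α) = ⟨β, y⟩ := by
  induction x with
  | zero => cases y with
    | zero => rfl
    | succ y => simp [pos] at h
  | succ x ih => cases y with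
    | zero => simp [pos] at h
    | succ y =>
      have := ih y (by simpa [pos] using h)
      cases this
      rfl

instance {B : Type u} {Γ : List (Ty B)} : Finite (Σ α, Var Γ α) :=
  Finite.of_injective (fun v => (⟨v.2.pos, v.2.pos_lt⟩ : Fin Γ.length)) fun v w h =>
    Var.eq_of_pos v.2 w.2 (by simpa using h)

theorem exists_idx_bound {U : Set (Sym S)} (hU : U.Finite) :
    ∃ N, ∀ α (x : FVar α), Sym.var α x ∈ U → x.idx < N := by
  let g : Sym S → ℕ
    | .var _ x => x.idx
    | .con _ _ _ => 0
  obtain ⟨N, hN⟩ := (hU.image g).bddAbove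
  exact ⟨N + 1, fun α x hx => Nat.lt_succ_of_le (hN ⟨_, hx, rfl⟩)⟩

namespace Subst

theorem apply_eq_gsub (θ : Subst S) {Γ : List (Ty S.Base)} {τ : Ty S.Base} (t : Term S Γ τ) :
    θ.apply t = t.gsub ⟨fun _ x => bvar x, fun α x => (θ α x).rename fun _ y => y.elimNil,
      fun _ _ c => con c⟩ := by
  induction t with
  | lam h t ih =>
    simp only [apply, gsub, ih]
    congr 2
    ext α x
    · cases x <;> rfl
    · change Term.rename _ (θ α x) = (Term.rename _ _).weaken
      rw [Term.weaken, rename_rename]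
      congr 1
      funext α y
      exact y.elimNil
    · rfl
  | _ => simp_all only [apply, gsub]

theorem apply_closed (θ : Subst S) {Γ : List (Ty S.Base)} {τ : Ty S.Base} {t : Term S Γ τ}
    (ht : t.Closed) : θ.apply t = t := by
  rw [apply_eq_gsub]
  refine Eq.trans ?_ (gsub_bvar t)
  exact gsub_congr t rfl (fun α x h => (ht α x h).elim) fun _ _ _ _ => rfl

theorem syms_finite {θ : Subst S} (h : θ.dom.Finite) : θ.syms.Finite :=
  h.biUnion fun _ _ => (Set.finite_singleton _).union (Term.syms_finite _)

theorem id_dom_finite : (Subst.id (S := S)).dom.Finite := by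
  have : (Subst.id (S := S)).dom = ∅ := by
    ext v
    simp [dom, id]
  rw [this]
  exact Set.finite_empty

end Subst

theorem rename_nil {τ : Ty S.Base} (t : Term S [] τ) (ρ : ∀ α, Var [] α → Var [] α) :
    t.rename ρ = t := by
  rw [rename_eq_gsub, ← bsubst_eq_gsub, bsubst_nil]

open Classical in
/-- Closed instances of clauses are obtained by renaming apart followed by a legal substitution. -/
theorem exists_renamesApart {U : Set (Sym S)} (hU : U.Finite) (i : ℕ) {Δ : List (Ty S.Base)}
    (σ : ∀ α, Var Δ α → Term S [] α) (hσ : ∀ α x, (σ α x).LevelLE i) :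
    ∃ (δ : ∀ α, Var Δ α → FVar α) (θ : Subst S), RenamesApart U i δ ∧ θ.Legal ∧
      (renSyms (S := S) δ).Finite ∧
      ∀ {τ : Ty S.Base} (t : Term S Δ τ), t.Closed → θ.apply (applyRen δ t) = t.bsubst σ := by
  obtain ⟨N, hN⟩ := exists_idx_bound hU
  -- Indices from `N` on do not occur in `U`, the position in the context keeps the variables
  -- distinct, and the label `i` makes the terms of `σ` legal values for them.
  let δ : ∀ α, Var Δ α → FVar α := fun α x => ⟨x.isObj, i, N + x.pos⟩
  have hδ : ∀ α (x y : Var Δ α), δ α x = δ α y → x = y := by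
    intro α x y h
    have h1 : N + x.pos = N + y.pos := congrArg FVar.idx h
    have := Var.eq_of_pos x y (by omega)
    cases this
    rfl
  let θ : Subst S := fun α v => if h : ∃ x : Var Δ α, δ α x = v then σ α h.choose else fvar v
  have hθ : ∀ α x, θ α (δ α x) = σ α x := by
    intro α x
    have h : ∃ y : Var Δ α, δ α y = δ α x := ⟨x, rfl⟩
    simp only [θ]
    rw [dif_pos h, hδ _ _ _ h.choose_spec]
  refine ⟨δ, θ, ⟨hδ, fun α x => ⟨le_rfl, fun h => ?_⟩⟩, ⟨?_, fun α v => ?_⟩, ?_, fun t ht => ?_⟩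
  · have := hN _ _ h
    simp [δ] at this
  · refine (Set.finite_range fun v : Σ α, Var Δ α => (⟨v.1, δ v.1 v.2⟩ : Σ α, FVar α)).subset ?_
    rintro ⟨α, v⟩ hv
    by_contra hc
    refine hv (dif_neg ?_)
    rintro ⟨x, hx⟩
    exact hc ⟨⟨α, x⟩, congrArg (Sigma.mk α) hx⟩
  · by_cases h : ∃ x : Var Δ α, δ α x = v
    · obtain ⟨x, rfl⟩ := h
      rw [hθ]
      exact hσ α x
    · rw [show θ α v = fvar v from dif_neg h]
      exact le_refl v.lev
  · refine (Set.finite_range fun v : Σ α, Var Δ α => Sym.var v.1 (δ v.1 v.2)).subset ?_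
    rintro _ ⟨α, x, rfl⟩
    exact ⟨⟨α, x⟩, rfl⟩
  · rw [Subst.apply_eq_gsub, applyRen, bsubst_eq_gsub, bsubst_eq_gsub, gsub_gsub]
    refine gsub_congr t ?_ (fun α x h => (ht α x h).elim) fun _ _ _ _ => rfl
    funext α x
    change (θ α (δ α x)).rename _ = σ α x
    rw [rename_nil, hθ]

/-- No logic variable occurs in a state. -/
def State.Closed (s : State S) : Prop := (∀ D ∈ s.prog, D.Closed) ∧ s.goal.Closed

theorem substProg_closed (θ : Subst S) {P : List (Term S [] .prog)} (h : ∀ D ∈ P, D.Closed) :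
    substProg θ P = P := by
  rw [substProg]
  conv_rhs => rw [← List.map_id P]
  exact List.map_congr_left fun D hD => θ.apply_closed (h D hD)

theorem substVec_closed (θ : Subst S) {V : List (State S)} (h : ∀ s ∈ V, s.Closed) :
    substVec θ V = V := by
  rw [substVec]
  conv_rhs => rw [← List.map_id V]
  refine List.map_congr_left fun s hs => ?_
  rw [substProg_closed θ (h s hs).1, θ.apply_closed (h s hs).2]
  rfl

theorem vecSyms_finite (V : List (State S)) : (vecSyms V).Finite :=
  V.finite_toSet.biUnion fun s _ =>
    (s.prog.finite_toSet.biUnion fun D _ => D.syms_finite).union s.goal.syms_finite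

/-! ### From unlabelled proofs to resolution -/

theorem exists_deriv_cons {U W : Set (Sym S)} {V V' : List (State S)} {θ : Subst S}
    (hs : Step U V θ W V') (hU : U.Finite) (hW : W.Finite) (hθ : θ.dom.Finite)
    (h : ∀ U' : Set (Sym S), U'.Finite → ∃ θ', Deriv U' V' θ' []) : ∃ θ, Deriv U V θ [] := by
  obtain ⟨θ', h'⟩ := h (U ∪ W ∪ θ.syms ∪ vecSyms V')
    (((hU.union hW).union (Subst.syms_finite hθ)).union (vecSyms_finite V'))
  exact ⟨_, .cons hs h'⟩

/-- The clause instances of a program after a symbol map. -/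
theorem Inst.map {D : Term S [] .prog} {G : Option (Term S [] .goal)} {A : Term S [] .rig}
    (h : Inst D G A) {κ : SymMap S} {i : ℕ} (hκ : κ.LE i) :
    ∃ (Δ : List (Ty S.Base)) (G' : Option (Term S Δ .goal)) (A' : Term S Δ .rig)
      (σ : ∀ α, Var Δ α → Term S [] α), ClauseOf (κ.map D) Δ (G'.map κ.map) (κ.map A') ∧
      (∀ α x, (σ α x).LevelLE i) ∧
      Option.Rel Conv (G'.map fun t => (κ.map t).bsubst σ) (G.map κ.map) ∧
      Conv ((κ.map A').bsubst σ) (κ.map A) := by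
  obtain ⟨Δ, G', A', σ, hc, hG, hA⟩ := h
  refine ⟨Δ, G', A', fun α x => κ.map (σ α x), κ.clauseOf_map hc,
    fun α x => SymMap.map_levelLE hκ _, ?_, ?_⟩
  · cases G' with
    | none => cases G with
      | none => exact .none
      | some g => cases hG
    | some g => cases G with
      | none => cases hG
      | some g' =>
        cases hG with
        | some h =>
          refine .some ?_
          simp only [← SymMap.map_bsubst]
          exact κ.map_conv h
  · rw [← SymMap.map_bsubst]
    exact κ.map_conv hA

-- Serves universal goals: the eigenconstant of the unlabelled proof is redirected to the fresh
-- constant of the generic step, and terms not containing it keep their images.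
open Classical in
theorem exists_symMap_update (κ : SymMap S) {i : ℕ} (hκ : κ.LE i) {j : ℕ} {α : Ty S.Base}
    (c : S.Con j α) (c' : S.Con (i + 1) α) :
    ∃ κ' : SymMap S, κ'.LE (i + 1) ∧ κ'.map (Γ := []) (con c) = con c' ∧
      ∀ {τ : Ty S.Base} (t : Term S [] τ), Sym.con j α c ∉ t.syms → κ'.map t = κ.map t := by
  refine ⟨⟨κ.f, fun l β d => if e : Sym.con l β d = Sym.con j α c then
    ⟨i + 1, by cases e; exact c'⟩ else κ.k l β d⟩, ⟨fun β x => (hκ.1 β x).trans (Nat.le_succ i),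
      fun l β d => ?_⟩, ?_, fun t ht => ?_⟩
  · by_cases e : Sym.con l β d = Sym.con j α c
    · simp [e]
    · simpa [e] using (hκ.2 l β d).trans (Nat.le_succ i)
  · exact congrArg conOf (dif_pos rfl)
  · refine gsub_congr t rfl (fun _ _ _ => rfl) fun l β d hd => ?_
    have e : Sym.con l β d ≠ Sym.con j α c := fun e => ht (e ▸ hd)
    exact congrArg conOf (dif_neg e)

/-- The state carries images under a symbol map with labels at most `i`, so witnesses automatically
lie over the right universe. The other states are handled by a continuation valid for every finite
set of used symbols; being closed, they are untouched by the unifiers of this branch. The list `Q`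
stands in for `p`, a single conjunction, of which only the clause instances matter. -/
theorem Prv.exists_deriv {p : World S} {G : Term S [] .goal} (h : Prv p G) {κ : SymMap S} {i : ℕ}
    (hκ : κ.LE i) {Q : List (Term S [] .prog)}
    (hQ : ∀ G A, p.Inst G A → ∃ D ∈ Q, Inst D G A) {G₀ : Term S [] .goal}
    (hG : Conv G₀ (κ.map G)) {V : List (State S)} (hV : ∀ s ∈ V, s.Closed) {U : Set (Sym S)}
    (hU : U.Finite) (hcont : ∀ U' : Set (Sym S), U'.Finite → ∃ θ, Deriv U' V θ []) :
    ∃ θ, Deriv U (⟨i, Q.map κ.map, G₀⟩ :: V) θ [] := by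
  have hQc : ∀ D ∈ Q.map κ.map, D.Closed := by
    intro D hD
    obtain ⟨D', _, rfl⟩ := List.mem_map.1 hD
    exact κ.map_closed D'
  induction h generalizing κ i Q G₀ V U with
  | conv hc _ ih => exact ih hκ hQ (hG.trans (κ.map_conv hc.symm)) hV hU hcont hQc
  | top p =>
    exact exists_deriv_cons (.null [] V i _ G₀ hG) hU Set.finite_empty Subst.id_dom_finite hcont
  | @and p G G' _ _ ih ih' =>
    -- The state of the second conjunct joins the tail, and its derivation becomes the continuation
    -- of the first.
    refine exists_deriv_cons (.and [] V i _ G₀ (κ.map G) (κ.map G') hG) hU Set.finite_empty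
      Subst.id_dom_finite fun U' hU' => ih hκ hQ (.refl _) ?_ hU' (fun U'' hU'' =>
        ih' hκ hQ (.refl _) hV hU'' hcont hQc) hQc
    intro s hs
    obtain rfl | hs := List.mem_cons.1 hs
    · exact ⟨hQc, κ.map_closed _⟩
    · exact hV s hs
  | @orL p G G' _ ih =>
    exact exists_deriv_cons (.orL [] V i _ G₀ (κ.map G) (κ.map G') hG) hU Set.finite_empty
      Subst.id_dom_finite fun U' hU' => ih hκ hQ (.refl _) hV hU' hcont hQc
  | @orR p G G' _ ih =>
    exact exists_deriv_cons (.orR [] V i _ G₀ (κ.map G) (κ.map G') hG) hU Set.finite_empty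
      Subst.id_dom_finite fun U' hU' => ih hκ hQ (.refl _) hV hU' hcont hQc
  | @imp p D G _ ih =>
    refine exists_deriv_cons (.augment [] V i _ G₀ (κ.map D) (κ.map G) hG) hU Set.finite_empty
      Subst.id_dom_finite fun U' hU' => ?_
    have hm : Q.map κ.map ++ [κ.map D] = (Q ++ [D]).map κ.map := by simp
    rw [List.nil_append, hm]
    refine ih hκ (fun G' A hi => ?_) (.refl _) hV hU' hcont fun D' hD' => ?_
    · obtain hi | hi := World.inst_and.1 hi
      · obtain ⟨E, hE, hi⟩ := hQ _ _ hi
        exact ⟨E, by simp [hE], hi⟩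
      · exact ⟨D, by simp, hi⟩
    · obtain ⟨E, _, rfl⟩ := List.mem_map.1 hD'
      exact κ.map_closed E
  | @sig p α hα F s _ ih =>
    -- The witness `s` may carry arbitrary labels; its image under `κ` does not exceed `i`.
    refine exists_deriv_cons (.instance [] V i _ G₀ hα (etaBody hα (κ.map F)) (κ.map s)
      (hG.trans (.app (.refl _) (Conv.eta hα _).symm)) (SymMap.map_levelLE hκ s)) hU
      Set.finite_empty Subst.id_dom_finite fun U' hU' => ?_
    rw [etaBody_inst]
    exact ih hκ hQ (.refl _) hV hU' hcont hQc
  | @pi p α hα F _ ih =>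
    -- Of all the premises only the one for a constant absent from `F` and `Q` is used. Its label is
    -- irrelevant, because `κ'` replaces it by `c'`, labelled `i + 1`.
    obtain ⟨c, hc⟩ := exists_fresh_con S hα 0
      (F.syms_finite.union (Q.finite_toSet.biUnion fun D _ => D.syms_finite))
    obtain ⟨c', hc'⟩ := exists_fresh_con S hα (i + 1) hU
    obtain ⟨κ', hκ', hcc, hsame⟩ := exists_symMap_update κ hκ c c'
    refine exists_deriv_cons (.generic [] V i _ G₀ hα (etaBody hα (κ.map F)) c'
      (hG.trans (.app (.refl _) (Conv.eta hα _).symm)) hc') hU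
      (Set.finite_singleton _) Subst.id_dom_finite fun U' hU' => ?_
    have hm : Q.map κ.map = Q.map κ'.map := List.map_congr_left fun D hD =>
      (hsame D fun h => hc (.inr (Set.mem_biUnion hD h))).symm
    rw [etaBody_inst, List.nil_append, hm]
    refine ih 0 c hκ' hQ ?_ hV hU' hcont (hm ▸ hQc)
    change Conv _ (Term.app (κ'.map F) (κ'.map (con c)))
    rw [hcc, hsame F fun h => hc (.inl h)]
    exact .refl _
  | @clause p G A hi _ ih =>
    obtain ⟨D, hD, hi⟩ := hQ _ _ hi
    obtain ⟨Δ, G', A', σ, hcl, hσ, hG', hA'⟩ := hi.map hκ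
    cases G' with
    | none => cases hG'
    | some B =>
    -- The atom, the program and the remaining states are closed, so the unifier `θ` merely
    -- instantiates the renamed clause by `σ`.
    obtain ⟨δ, θ, hδ, hθ, hfin, happ⟩ := exists_renamesApart hU i σ hσ
    have hst := Step.backchain (U := U) [] V i (Q.map κ.map) G₀ (κ.map A) (κ.map D) Δ (κ.map B)
      (κ.map A') δ θ hG (List.mem_map_of_mem hD) hcl hδ hθ
      (by rw [happ _ (κ.map_closed _), θ.apply_closed (κ.map_closed _)]; exact hA'.symm)
    rw [substVec_closed θ hV, substProg_closed θ hQc, happ _ (κ.map_closed _)] at hst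
    refine exists_deriv_cons hst hU hfin hθ.1 fun U' hU' => ?_
    cases hG' with
    | some hG' => exact ih hκ hQ hG' hV hU' hcont hQc
  | @fact p A hi =>
    obtain ⟨D, hD, hi⟩ := hQ _ _ hi
    obtain ⟨Δ, G', A', σ, hcl, hσ, hG', hA'⟩ := hi.map hκ
    cases G' with
    | some B => cases hG'
    | none =>
    obtain ⟨δ, θ, hδ, hθ, hfin, happ⟩ := exists_renamesApart hU i σ hσ
    have hst := Step.axiomStep (U := U) [] V i (Q.map κ.map) G₀ (κ.map A) (κ.map D) Δ
      (κ.map A') δ θ hG (List.mem_map_of_mem hD) hcl hδ hθ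
      (by rw [happ _ (κ.map_closed _), θ.apply_closed (κ.map_closed _)]; exact hA'.symm)
    rw [substVec_closed θ hV] at hst
    exact exists_deriv_cons hst hU hfin hθ.1 hcont

-- The initial map fixes constants labelled at most `i` and collapses every other symbol to some
-- constant labelled `i` of the same type. Injectivity is not needed: only eigenconstants must be
-- fresh, and `exists_symMap_update` redirects these separately.
open Classical in
theorem exists_symMap (S : Sig.{u}) (i : ℕ) : ∃ κ : SymMap S, κ.LE i ∧
    ∀ {τ : Ty S.Base} (t : Term S [] τ), t.LevelLE i → t.Closed → κ.map t = t := by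
  have hne : ∀ α : Ty S.Base, α.IsObj ∨ α.IsRigid → Nonempty (S.Con i α) := fun α h =>
    have := S.con_infinite i α h
    inferInstance
  let κ : SymMap S :=
    ⟨fun α x => ⟨i, (hne α (.inl x.obj)).some⟩, fun j α c =>
      if j ≤ i then ⟨j, c⟩ else ⟨i, (hne α (S.con_type j α c)).some⟩⟩
  have key : ∀ {Γ : List (Ty S.Base)} {τ : Ty S.Base} (t : Term S Γ τ), t.LevelLE i → t.Closed →
      κ.map t = t := by
    intro Γ τ t ht hc
    induction t with
    | bvar x => rfl
    | fvar x => exact (hc _ x rfl).elim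
    | con c => exact congrArg conOf (if_pos ht)
    | log c => rfl
    | app s t ih ih' =>
      exact congrArg₂ Term.app (ih ht.1 fun α x h => hc α x (.inl h))
        (ih' ht.2 fun α x h => hc α x (.inr h))
    | lam h t ih => rw [SymMap.map_lam, ih ht hc]
    | incAR t ih => exact congrArg Term.incAR (ih ht hc)
    | incHA t ih => exact congrArg Term.incHA (ih ht hc)
    | incPR t ih => exact congrArg Term.incPR (ih ht hc)
    | incGH t ih => exact congrArg Term.incGH (ih ht hc)
  refine ⟨κ, ⟨fun _ _ => le_rfl, fun j α c => ?_⟩, key⟩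
  by_cases h : j ≤ i
  · simp [κ, h]
  · simp [κ, h]

end UCTT

/-! ### The completeness theorem -/

theorem mainTheorem4 (S : UCTT.Sig.{u}) (i : ℕ)
    (P : List (UCTT.Term S [] UCTT.Ty.prog)) (G : UCTT.Term S [] UCTT.Ty.goal)
    (hP : ∀ D ∈ P, D.LevelLE i) (hG : G.LevelLE i)
    (hPc : ∀ D ∈ P, D.Closed) (hGc : G.Closed)
    (htrue : ∀ (𝔄 : UCTT.UniformAlgebra S) (φ : 𝔄.Assignment), 𝔄.truth i φ P G hP hG = ⊤) :
    ∃ θ : UCTT.Subst S, UCTT.Resolves [⟨i, P, G⟩] θ ∧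
      ∀ (α : UCTT.Ty S.Base) (x : UCTT.FVar α),
        UCTT.Sym.var α x ∈ UCTT.State.syms ⟨i, P, G⟩ →
          UCTT.Term.Conv (θ α x) (UCTT.Term.fvar x) := by
  obtain ⟨p, hp, hinst⟩ := UCTT.exists_prv hP hG htrue
  obtain ⟨κ, hκ, hmap⟩ := UCTT.exists_symMap S i
  have hPm : P.map κ.map = P := by
    conv_rhs => rw [← List.map_id P]
    exact List.map_congr_left fun D hD => hmap D (hP D hD) (hPc D hD)
  obtain ⟨θ, hθ⟩ := hp.exists_deriv hκ hinst (G₀ := G)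
    (by rw [hmap G hG hGc]; exact .refl _) (V := []) (by simp)
    (UCTT.vecSyms_finite [⟨i, P, G⟩]) fun U' _ => ⟨_, .nil U' []⟩
  rw [hPm] at hθ
  -- `P` and `G` are closed, so the condition on free variables is vacuous.
  refine ⟨θ, hθ, fun α x hx => ?_⟩
  obtain hx | hx := hx
  · simp only [Set.mem_iUnion] at hx
    obtain ⟨D, hD, hx⟩ := hx
    exact (hPc D hD α x hx).elim
  · exact (hGc α x hx).elim
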